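/- Let $(S,m)$ be a compact metric space and let $(\Omega,\mathcal F,(\mathcal F_t)_{t\ge0},(\mathbb P_x)_{x\in S})$ be a measurable space with a right-continuous filtration and a measurable family of probability measures. Let $(V_t)_{t\ge0}$ be an $(\mathcal F_t)$-adapted $S$-valued Feller process with c\`adl\`ag paths, i.e. $\mathbb P_x(V_0=x)=1$ for all $x\in S$, the time-homogeneous Markov property with respect to $(\mathcal F_t)$ holds under every $\mathbb P_x$, and $x\mapsto\mathbb E_x[h(V_t)]$ is continuous for every $t\ge 0$ and every continuous $h:S\to\mathbb R$. For a probability measure $\mu$ on $S$ put $\mathbb P_\mu=\int_S\mathbb P_y\,\mu(\mathrm dy)$. Assume: (i) $(V_t)$ has a unique invariant probability measure $\pi$. (ii) For every $x\in S$ there are c\`adl\`ag processes $(V^x_t)_{t\ge 0}$ and $(V^\pi_t)_{t\ge 0}$, defined on a common probability space $(\tilde\Omega,\tilde{\mathcal F},\tilde{\mathbb P})$, whose finite-dimensional distributions are those of $(V_t)$ under $\mathbb P_x$ and under $\mathbb P_\pi$, respectively. (iii) $T^x=\inf\{t\ge0: V^x_t=V^\pi_t\}$ is a stopping time (for some filtration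 to which both processes are adapted), and there are constants $C,\delta>0$ with $\sup_{x\in S}\tilde{\mathbb P}(T^x\ge t)\le Ce^{-\delta t}$ for all $t\ge0$. Let $f:\mathbb R^K\times S\to\mathbb R$ be continuous and twice continuously differentiable in $\theta\in\mathbb R^K$, such that $\nabla_\theta f$ and the Hessian $H_\theta f$ are continuous on $\mathbb R^K\times S$, $\nabla_\theta f(\cdot,y)$ is Lipschitz with a constant independent of $y\in S$, and $f(\theta,\cdot)$ and $\nabla_\theta f(\theta,\cdot)$ are $\pi$-integrable for every $\theta$. Let $\theta_0\in\mathbb R^K$. For $\varepsilon>0$ let $(\theta^\varepsilon_t)_{t\ge0}$ be the process with continuous paths that solves, $\mathbb P_\pi$-almost surely, $$\mathrm d\theta^\varepsilon_t=-\nabla_\theta f(\theta^\varepsilon_t,V_{t/\varepsilon})\,\mathrm dt,\qquad \theta^\varepsilon_0=\theta_0,$$ and let $(\zeta_t)_{t\ge0}$ solve the full gradient flow $$\mathrm d\zeta_t=-\Big[\int_S\nabla_\theta f(\zeta_t,v)\,\pi(\mathrm dv)\Big]\mathrm dt,\qquad \zeta_0=\theta_0.$$ Then, as $\varepsilon\to0$,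 $(\theta^\varepsilon_t)_{t\ge0}$ under $\mathbb P_\pi$ converges weakly to $(\zeta_t)_{t\ge0}$ in the space $\mathcal C([0,\infty);\mathbb R^K)$ of continuous functions equipped with the distance $$\rho(\varphi,\varphi')=\int_0^\infty e^{-t}\Big(1\wedge\sup_{0\le s\le t}\|\varphi_s-\varphi'_s\|\Big)\mathrm dt;$$ that is, for every bounded continuous $F:\mathcal C([0,\infty);\mathbb R^K)\to\mathbb R$, the random variable $F((\theta^\varepsilon_t)_{t\ge0})$ is $\mathbb P_\pi$-integrable for every $\varepsilon>0$ and $$\mathbb E_\pi\big[F\big((\theta^\varepsilon_t)_{t\ge0}\big)\big]\longrightarrow\mathbb E_\pi\big[F\big((\zeta_t)_{t\ge0}\big)\big]=F\big((\zeta_t)_{t\ge0}\big)\qquad(\varepsilon\to0).$$ -/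

import Mathlib

open MeasureTheory ProbabilityTheory Filter Topology
open scoped NNReal ENNReal

universe u v w

noncomputable section

namespace SGP

/-- A path `[0,∞) → S` that is right continuous with left limits. -/
def IsCadlag {S : Type u} [TopologicalSpace S] (p : ℝ≥0 → S) : Prop :=
  (∀ t, ContinuousWithinAt p (Set.Ici t) t) ∧ ∀ t, ∃ l, Tendsto p (𝓝[<] t) (𝓝 l)

/-- `(V_t)` is a càdlàg Feller process on the compact space `S`, with respect to the right
continuous filtration `𝓕` and the family of laws `(P x)`, where `P x` makes the process start at
`x`. (Strong continuity of the semigroup at time `0` follows from right continuity of the paths.) -/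
structure IsFellerProcess {S : Type u} [TopologicalSpace S] [MeasurableSpace S]
    {Ω : Type v} {mΩ : MeasurableSpace Ω} (𝓕 : Filtration ℝ≥0 mΩ)
    (V : ℝ≥0 → Ω → S) (P : Kernel S Ω) : Prop where
  rightCont : 𝓕.IsRightContinuous
  adapted : Adapted 𝓕 V
  cadlag : ∀ ω, IsCadlag fun t => V t ω
  prob : ∀ x, IsProbabilityMeasure (P x)
  start : ∀ x, ∀ᵐ ω ∂(P x), V 0 ω = x
  /-- The time-homogeneous Markov property. -/
  markov : ∀ (x : S) (s t : ℝ≥0) (h : S → ℝ), Measurable h → (∃ M, ∀ y, |h y| ≤ M) →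
    (P x)[fun ω => h (V (s + t) ω) | 𝓕 s] =ᵐ[P x] fun ω => ∫ ω', h (V t ω') ∂(P (V s ω))
  /-- The transition semigroup maps continuous functions to continuous functions. -/
  feller : ∀ (t : ℝ≥0) (h : S → ℝ), Continuous h → Continuous fun x => ∫ ω, h (V t ω) ∂(P x)

/-- The probability measure `π` on `S` is invariant for the process: if `V_0 ∼ π` then
`V_t ∼ π` for all `t`, i.e. `∫ P_x(V_t ∈ A) π(dx) = π(A)`. -/
def IsInvariantLaw {S : Type u} [MeasurableSpace S] {Ω : Type v} [MeasurableSpace Ω]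
    (V : ℝ≥0 → Ω → S) (P : Kernel S Ω) (π : Measure S) : Prop :=
  IsProbabilityMeasure π ∧ ∀ t, Kernel.Invariant (P.map (V t)) π

/-- The processes `X` under `μ` and `Y` under `ν` have the same finite-dimensional distributions. -/
def SameFDD {S : Type u} [MeasurableSpace S] {Ω : Type v} [MeasurableSpace Ω]
    {Ω' : Type w} [MeasurableSpace Ω'] (X : ℝ≥0 → Ω → S) (μ : Measure Ω)
    (Y : ℝ≥0 → Ω' → S) (ν : Measure Ω') : Prop :=
  ∀ (n : ℕ) (t : Fin n → ℝ≥0) (A : Fin n → Set S), StrictMono t → (∀ i, MeasurableSet (A i)) →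
    μ {ω | ∀ i, X (t i) ω ∈ A i} = ν {ω | ∀ i, Y (t i) ω ∈ A i}

/-- The first meeting time `inf {t ≥ 0 | X_t = Y_t}`, equal to `⊤` if the two never meet. -/
def meetingTime {S : Type u} {Ω : Type v} (X Y : ℝ≥0 → Ω → S) : Ω → WithTop ℝ≥0 :=
  hittingAfter (fun t ω => (X t ω, Y t ω)) (Set.diagonal S) 0

/-- Assumptions on the index process: it has the unique invariant probability measure `π`, and for
every `x` the process started at `x` can be coupled, on some probability space, with a stationary
version such that the first meeting time has exponential tails, uniformly in `x`.
The law of `V` started from `π` is `π.bind P = ∫ P_y(·) π(dy)`. -/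
structure IndexAssumption {S : Type u} [TopologicalSpace S] [MeasurableSpace S]
    {Ω : Type v} [MeasurableSpace Ω]
    (V : ℝ≥0 → Ω → S) (P : Kernel S Ω) (π : Measure S) : Prop where
  invariant : IsInvariantLaw V P π
  unique : ∀ μ : Measure S, IsInvariantLaw V P μ → μ = π
  coupling : ∃ C δ : ℝ, 0 < C ∧ 0 < δ ∧ ∀ x : S,
    ∃ (Ω' : Type w) (m' : MeasurableSpace Ω') (Q : Measure Ω') (Vx Vπ : ℝ≥0 → Ω' → S)
      (𝓖 : Filtration ℝ≥0 m'),
      IsProbabilityMeasure Q ∧ Adapted 𝓖 Vx ∧ Adapted 𝓖 Vπ ∧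
      (∀ ω, IsCadlag fun t => Vx t ω) ∧ (∀ ω, IsCadlag fun t => Vπ t ω) ∧
      SameFDD Vx Q V (P x) ∧ SameFDD Vπ Q V (π.bind P) ∧
      IsStoppingTime 𝓖 (meetingTime Vx Vπ) ∧
      ∀ t : ℝ≥0, Q {ω | (t : WithTop ℝ≥0) ≤ meetingTime Vx Vπ ω} ≤
        ENNReal.ofReal (C * Real.exp (-δ * t))

/-- Assumptions on the subsampled target function `f : ℝ^K × S → ℝ`: it is continuous, twice
continuously differentiable in `θ` with gradient and Hessian in `θ` jointly continuous, the gradient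
is Lipschitz in `θ` uniformly in `y`, and `f(θ,·)`, `∇_θ f(θ,·)` are `π`-integrable. -/
structure TargetAssumption {K : ℕ} {S : Type u} [TopologicalSpace S] [MeasurableSpace S]
    (f : EuclideanSpace ℝ (Fin K) → S → ℝ) (π : Measure S) : Prop where
  cont : Continuous fun p : EuclideanSpace ℝ (Fin K) × S => f p.1 p.2
  contDiff : ∀ y, ContDiff ℝ 2 fun θ => f θ y
  cont_grad : Continuous fun p : EuclideanSpace ℝ (Fin K) × S => gradient (fun θ => f θ p.2) p.1
  cont_hess : Continuous fun p : EuclideanSpace ℝ (Fin K) × S =>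
    fderiv ℝ (gradient fun θ => f θ p.2) p.1
  lipschitz : ∃ L : ℝ≥0, ∀ y, LipschitzWith L (gradient fun θ => f θ y)
  integrable : ∀ θ, Integrable (f θ) π
  integrable_grad : ∀ θ, Integrable (fun y => gradient (fun x => f x y) θ) π

/-- The path `θ` solves `dθ_t = -∇_θ f(θ_t, p_{t/ε}) dt` with initial value `θ₀`, where `p` is the
path of the index process. -/
def SolvesSGPC {K : ℕ} {S : Type u} (f : EuclideanSpace ℝ (Fin K) → S → ℝ) (ε : ℝ)
    (θ₀ : EuclideanSpace ℝ (Fin K)) (p : ℝ≥0 → S) (θ : C(ℝ≥0, EuclideanSpace ℝ (Fin K))) : Prop :=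
  ∀ t : ℝ≥0, θ t =
    θ₀ - ∫ s in (0 : ℝ)..t, gradient (fun x => f x (p (s / ε).toNNReal)) (θ s.toNNReal)

/-- The path `ζ` solves the full gradient flow `dζ_t = -(∫ ∇f(ζ_t, v) π(dv)) dt` with initial
value `θ₀`. -/
def SolvesFullFlow {K : ℕ} {S : Type u} [MeasurableSpace S]
    (f : EuclideanSpace ℝ (Fin K) → S → ℝ) (π : Measure S)
    (θ₀ : EuclideanSpace ℝ (Fin K)) (ζ : C(ℝ≥0, EuclideanSpace ℝ (Fin K))) : Prop :=
  ∀ t : ℝ≥0, ζ t =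
    θ₀ - ∫ s in (0 : ℝ)..t, ∫ v, gradient (fun x => f x v) (ζ s.toNNReal) ∂π

/-- The distance `ρ(φ,ψ) = ∫_0^∞ e^{-t} (1 ∧ sup_{0 ≤ s ≤ t} ‖φ_s - ψ_s‖) dt` on `C([0,∞); ℝ^K)`. -/
def pathDist {K : ℕ} (φ ψ : C(ℝ≥0, EuclideanSpace ℝ (Fin K))) : ℝ :=
  ∫ t in Set.Ioi (0 : ℝ),
    Real.exp (-t) * min 1 (⨆ s : Set.Icc (0 : ℝ≥0) t.toNNReal, ‖φ s - ψ s‖)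

/-- Continuity of a functional on path space with respect to the distance `pathDist`. -/
def PathContinuous {K : ℕ} (F : C(ℝ≥0, EuclideanSpace ℝ (Fin K)) → ℝ) : Prop :=
  ∀ φ, ∀ η > 0, ∃ δ > 0, ∀ ψ, pathDist φ ψ < δ → |F φ - F ψ| < η

end SGP

end

/-! The fast index process averages out. With `T = ε⁻¹` the flow sees `V` at time `T * s`, and over
a macroscopic window its gradient field should act like its `π`-mean.

Ergodicity comes from uniqueness of the invariant law. By a Krylov–Bogoliubov argument, every limit
point of the occupation laws started at `x` is invariant, hence equal to `π`; so time averages of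
expectations converge for each starting point (`tendsto_integral_occupation`). Under the stationary
law, conditioning on `V 0` turns this into decay of the averaged autocovariance. The second moment
of a centred time average is an integral of such averages, so it vanishes as well
(`tendsto_integral_sq_average`).

The flow is then compared with `ζ` pathwise. Gronwall reduces the distance to the time integral of
`g - gbar` along the deterministic path `ζ`. Freezing `ζ` on a finite grid bounds that integral by
finitely many ergodic averages and a small constant (`exists_averaging_bound`). Hence the distance
on a bounded interval is small off an event of small probability, and bounded continuity of `F`
gives the limit of expectations.

Measurability of `F (θ ε ω)` is a separate matter, since `θ` is only assumed to solve the equation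
almost surely. Picard iterates are measurable and converge to the solution, so its evaluations are
measurable off a null set, and evaluations generate the Borel structure of path space. -/

namespace SGP

set_option linter.unusedSectionVars false

/-! ### Markov property, stationarity and unique ergodicity. -/

section Ergodic

/-- A process with right continuous paths and measurable marginals is jointly measurable. -/
theorem measurable_uncurry_of_rightContinuous {S : Type*} [TopologicalSpace S]
    [TopologicalSpace.PseudoMetrizableSpace S] [MeasurableSpace S] [BorelSpace S]
    {Ω : Type*} [MeasurableSpace Ω] {V : ℝ≥0 → Ω → S} (hm : ∀ t, Measurable (V t))
    (hc : ∀ ω t, ContinuousWithinAt (fun t => V t ω) (Set.Ici t) t) :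
    Measurable (fun p : ℝ≥0 × Ω => V p.1 p.2) := by
  -- The grid point of mesh `1 / (n + 1)` strictly to the right of `t`: right continuity applies,
  -- and each `a n` has countably many values.
  set a : ℕ → ℝ≥0 → ℝ≥0 := fun n t => (⌊((n : ℝ≥0) + 1) * t⌋₊ + 1) / ((n : ℝ≥0) + 1) with ha
  have hlim : ∀ t, Tendsto (fun n => a n t) atTop (𝓝[Set.Ici t] t) := by
    intro t
    refine tendsto_nhdsWithin_iff.2 ⟨?_, Eventually.of_forall fun n => ?_⟩
    · have h0 : Tendsto (fun n : ℕ => t + 1 / ((n : ℝ≥0) + 1)) atTop (𝓝 (t + 0)) :=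
        tendsto_const_nhds.add tendsto_one_div_add_atTop_nhds_zero_nat
      rw [add_zero] at h0
      refine tendsto_of_tendsto_of_tendsto_of_le_of_le tendsto_const_nhds h0 ?_ ?_
      · intro n
        simp only [ha]
        rw [le_div_iff₀ (by positivity), mul_comm]
        exact (Nat.lt_floor_add_one _).le
      · intro n
        have hn : (0 : ℝ≥0) < (n : ℝ≥0) + 1 := by positivity
        simp only [ha]
        calc _ ≤ (((n : ℝ≥0) + 1) * t + 1) / ((n : ℝ≥0) + 1) := by
              gcongr
              exact Nat.floor_le (by positivity)
          _ = _ := by field_simp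
    · simp only [ha, Set.mem_Ici]
      rw [le_div_iff₀ (by positivity), mul_comm]
      exact (Nat.lt_floor_add_one _).le
  refine measurable_of_tendsto_metrizable (f := fun n (p : ℝ≥0 × Ω) => V (a n p.1) p.2) ?_ ?_
  · intro n
    have h1 : Measurable (fun q : ℕ × Ω => V (((q.1 : ℝ≥0) + 1) / ((n : ℝ≥0) + 1)) q.2) :=
      measurable_from_prod_countable_right fun k => hm (((k : ℝ≥0) + 1) / ((n : ℝ≥0) + 1))
    exact h1.comp (f := fun p : ℝ≥0 × Ω => (⌊((n : ℝ≥0) + 1) * p.1⌋₊, p.2))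
      ((Nat.measurable_floor.comp (measurable_fst.const_mul _)).prodMk measurable_snd)
  · rw [tendsto_pi_nhds]
    intro p
    exact (hc p.2 p.1).tendsto.comp (hlim p.1)

variable {S : Type u} [MetricSpace S] [CompactSpace S] [MeasurableSpace S] [BorelSpace S]
  {Ω : Type v} {mΩ : MeasurableSpace Ω} {𝓕 : Filtration ℝ≥0 mΩ}
  {V : ℝ≥0 → Ω → S} {P : Kernel S Ω} {π : Measure S}

theorem IsFellerProcess.measurable (hV : IsFellerProcess 𝓕 V P) (t : ℝ≥0) : Measurable (V t) :=
  (hV.adapted t).mono (𝓕.le t) le_rfl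

theorem IsFellerProcess.measurable_uncurry (hV : IsFellerProcess 𝓕 V P) :
    Measurable (fun p : ℝ≥0 × Ω => V p.1 p.2) :=
  measurable_uncurry_of_rightContinuous hV.measurable fun ω => (hV.cadlag ω).1

theorem IsFellerProcess.isMarkovKernel (hV : IsFellerProcess 𝓕 V P) : IsMarkovKernel P :=
  ⟨hV.prob⟩

/-- Integrated form of the Markov property. -/
theorem IsFellerProcess.integral_mul_comp_add (hV : IsFellerProcess 𝓕 V P) (x : S) (s t : ℝ≥0)
    {W : Ω → ℝ} (hW : Measurable[𝓕 s] W) {B : ℝ} (hWB : ∀ ω, |W ω| ≤ B)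
    {h : S → ℝ} (hh : Measurable h) {M : ℝ} (hM : ∀ y, |h y| ≤ M) :
    ∫ ω, W ω * h (V (s + t) ω) ∂(P x) =
      ∫ ω, W ω * (∫ ω', h (V t ω') ∂(P (V s ω))) ∂(P x) := by
  have := hV.isMarkovKernel
  have hinteg : Integrable (fun ω => h (V (s + t) ω)) (P x) :=
    Integrable.of_bound (hh.comp (hV.measurable _)).aestronglyMeasurable M
      (Eventually.of_forall fun ω => hM _)
  have hWint : Integrable (W * fun ω => h (V (s + t) ω)) (P x) :=
    hinteg.bdd_mul (c := B) (hW.mono (𝓕.le s) le_rfl).aestronglyMeasurable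
      (Eventually.of_forall fun ω => hWB ω)
  have h1 := condExp_mul_of_stronglyMeasurable_left (μ := P x) hW.stronglyMeasurable hWint hinteg
  have h2 := integral_condExp (μ := P x) (f := W * fun ω => h (V (s + t) ω)) (𝓕.le s)
  have h3 : ∫ ω, W ω * h (V (s + t) ω) ∂(P x) = ∫ ω, (W * fun ω => h (V (s + t) ω)) ω ∂(P x) := rfl
  rw [h3, ← h2]
  refine integral_congr_ae ?_
  filter_upwards [h1, hV.markov x s t h hh ⟨M, hM⟩] with ω h4 h5
  rw [h4, Pi.mul_apply, h5]

/-- Disintegration of integrals with respect to the law started from `π`. -/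
theorem integral_bind_kernel {α β : Type*} [MeasurableSpace α] [MeasurableSpace β]
    (κ : Kernel α β) (μ : Measure α) {X : β → ℝ} (hX : Integrable X (μ.bind κ)) :
    ∫ ω, X ω ∂(μ.bind κ) = ∫ x, ∫ ω, X ω ∂(κ x) ∂μ := by
  have := Kernel.integral_comp (η := κ) (κ := Kernel.const Unit μ) (a := ()) (f := X)
  simpa [Kernel.comp_apply] using this (by simpa [Kernel.comp_apply] using hX)

theorem IsInvariantLaw.map_eq (hV : IsFellerProcess 𝓕 V P) (hπ : IsInvariantLaw V P π)
    (t : ℝ≥0) : (π.bind P).map (V t) = π := by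
  rw [Measure.map_comp _ _ (hV.measurable t)]
  exact hπ.2 t

theorem IsInvariantLaw.isProbabilityMeasure_bind (hV : IsFellerProcess 𝓕 V P)
    (hπ : IsInvariantLaw V P π) : IsProbabilityMeasure (π.bind P) := by
  have := hV.isMarkovKernel
  have := hπ.1
  infer_instance

theorem IsInvariantLaw.integral_comp (hV : IsFellerProcess 𝓕 V P) (hπ : IsInvariantLaw V P π)
    (t : ℝ≥0) {φ : S → ℝ} (hφ : Measurable φ) :
    ∫ ω, φ (V t ω) ∂(π.bind P) = ∫ x, φ x ∂π := by
  conv_rhs => rw [← hπ.map_eq hV t]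
  rw [integral_map (hV.measurable t).aemeasurable hφ.aestronglyMeasurable]

theorem measurable_integral_marginal (hV : IsFellerProcess 𝓕 V P) (t : ℝ≥0) {φ : S → ℝ}
    (hφ : Measurable φ) : Measurable fun x => ∫ ω, φ (V t ω) ∂(P x) := by
  have := hV.isMarkovKernel
  have h : StronglyMeasurable (fun ω => φ (V t ω)) := (hφ.comp (hV.measurable t)).stronglyMeasurable
  exact h.integral_kernel.measurable

/-- Under the stationary law the two-time correlations only depend on the time difference. -/
theorem IsInvariantLaw.integral_mul_comp_add (hV : IsFellerProcess 𝓕 V P)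
    (hπ : IsInvariantLaw V P π) (s t : ℝ≥0) {h : S → ℝ} (hh : Measurable h) {M : ℝ}
    (hM : ∀ y, |h y| ≤ M) :
    ∫ ω, h (V s ω) * h (V (s + t) ω) ∂(π.bind P) =
      ∫ x, h x * (∫ ω, h (V t ω) ∂(P x)) ∂π := by
  have := hV.isMarkovKernel
  have := hπ.isProbabilityMeasure_bind hV
  have hms := hh.comp (hV.measurable s)
  have hmt := measurable_integral_marginal hV t hh
  have hb : ∀ x, |∫ ω, h (V t ω) ∂(P x)| ≤ M := fun x => by
    have := norm_integral_le_of_norm_le_const (μ := P x) (f := fun ω => h (V t ω)) (C := M)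
      (Eventually.of_forall fun ω => hM _)
    simpa using this
  have hi1 : Integrable (fun ω => h (V s ω) * h (V (s + t) ω)) (π.bind P) := by
    refine Integrable.of_bound (C := M * M)
      (hms.mul (hh.comp (hV.measurable (s + t)))).aestronglyMeasurable
      (Eventually.of_forall fun ω => ?_)
    rw [norm_mul]
    exact mul_le_mul (hM _) (hM _) (abs_nonneg _) ((abs_nonneg _).trans (hM (V s ω)))
  have hi2 : Integrable (fun ω => h (V s ω) * (∫ ω', h (V t ω') ∂(P (V s ω)))) (π.bind P) := by
    refine Integrable.of_bound (C := M * M)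
      (hms.mul (hmt.comp (hV.measurable s))).aestronglyMeasurable
      (Eventually.of_forall fun ω => ?_)
    rw [norm_mul]
    exact mul_le_mul (hM _) (hb _) (abs_nonneg _) ((abs_nonneg _).trans (hM (V s ω)))
  -- Invariance moves the `π`-integral on the right to time `s`; after disintegrating over the
  -- starting point, the Markov property at `s` with weight `h (V s)` finishes.
  rw [← hπ.integral_comp hV s (φ := fun x => h x * (∫ ω, h (V t ω) ∂(P x))) (hh.mul hmt),
    integral_bind_kernel P π hi1, integral_bind_kernel P π hi2]
  congr 1
  ext x
  exact hV.integral_mul_comp_add x s t (hh.comp (hV.adapted s)) (fun ω => hM _) hh hM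

/-- After rescaling, the windows `[t, T + t]` and `[0, T]` differ only in two end pieces of length
`t`, so the averages differ by at most `2 * M * t / T`. This makes limits of occupation laws
invariant. -/
theorem tendsto_integral_shift_sub {m : ℝ → ℝ} (hm : Measurable m) {M : ℝ}
    (hM : ∀ s, |m s| ≤ M) {t : ℝ} (ht : 0 ≤ t) :
    Tendsto (fun T : ℝ => (∫ r in (0 : ℝ)..1, m (T * r + t)) - ∫ r in (0 : ℝ)..1, m (T * r))
      atTop (𝓝 0) := by
  have hi : ∀ a b : ℝ, IntervalIntegrable m volume a b := fun a b => by
    rw [intervalIntegrable_iff]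
    exact Measure.integrableOn_of_bounded (M := M) (by simp) hm.aestronglyMeasurable
      (Eventually.of_forall fun s => hM s)
  have hb : ∀ a b : ℝ, ‖∫ r in a..b, m r‖ ≤ M * |b - a| := fun a b =>
    intervalIntegral.norm_integral_le_of_norm_le_const fun s _ => hM s
  have hlim : Tendsto (fun T : ℝ => T⁻¹ * (2 * M * t)) atTop (𝓝 0) := by
    simpa using tendsto_inv_atTop_zero.mul_const (2 * M * t)
  refine squeeze_zero_norm' ?_ hlim
  filter_upwards [eventually_gt_atTop 0] with T hT
  rw [intervalIntegral.integral_comp_mul_add _ hT.ne',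
    intervalIntegral.integral_comp_mul_left _ hT.ne']
  have hsub : (∫ r in t..(T + t), m r) - (∫ r in (0 : ℝ)..T, m r) =
      (∫ r in T..(T + t), m r) - ∫ r in (0 : ℝ)..t, m r := by
    have e1 := intervalIntegral.integral_add_adjacent_intervals (hi 0 t) (hi t (T + t))
    have e2 := intervalIntegral.integral_add_adjacent_intervals (hi 0 T) (hi T (T + t))
    linarith
  simp only [mul_zero, zero_add, mul_one, smul_eq_mul]
  rw [← mul_sub, hsub, norm_mul, Real.norm_of_nonneg (inv_nonneg.2 hT.le)]
  have h1 := hb T (T + t)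
  have h2 := hb 0 t
  simp only [add_sub_cancel_left, sub_zero, abs_of_nonneg ht] at h1 h2
  gcongr
  calc _ ≤ ‖∫ r in T..(T + t), m r‖ + ‖∫ r in (0 : ℝ)..t, m r‖ := norm_sub_le _ _
    _ ≤ _ := by linarith

theorem IsFellerProcess.measurable_rescaled (hV : IsFellerProcess 𝓕 V P) (T : ℝ) :
    Measurable fun p : ℝ × Ω => V (T * p.1).toNNReal p.2 :=
  hV.measurable_uncurry.comp
    (((measurable_fst.const_mul T).real_toNNReal).prodMk measurable_snd)

theorem IsFellerProcess.measurable_comp_rescaled (hV : IsFellerProcess 𝓕 V P) {φ : S → ℝ}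
    (hφ : Measurable φ) (T : ℝ) : Measurable fun p : ℝ × Ω => φ (V (T * p.1).toNNReal p.2) :=
  hφ.comp (hV.measurable_rescaled T)

/-- The law at a uniform random time in `[0, T]` of the process started at `x`. -/
noncomputable def occupation (V : ℝ≥0 → Ω → S) (P : Kernel S Ω) (x : S) (T : ℝ) : Measure S :=
  ((volume.restrict (Set.Ioc (0 : ℝ) 1)).prod (P x)).map fun p => V (T * p.1).toNNReal p.2

theorem isProbabilityMeasure_occupation (hV : IsFellerProcess 𝓕 V P) (x : S) (T : ℝ) :
    IsProbabilityMeasure (occupation V P x T) := by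
  have := hV.prob x
  have : IsProbabilityMeasure (volume.restrict (Set.Ioc (0 : ℝ) 1)) := ⟨by simp⟩
  exact Measure.isProbabilityMeasure_map (hV.measurable_rescaled T).aemeasurable

theorem integral_occupation (hV : IsFellerProcess 𝓕 V P) (x : S) (T : ℝ) {φ : S → ℝ}
    (hφ : Measurable φ) {M : ℝ} (hM : ∀ y, |φ y| ≤ M) :
    ∫ y, φ y ∂(occupation V P x T) =
      ∫ r in (0 : ℝ)..1, ∫ ω, φ (V (T * r).toNNReal ω) ∂(P x) := by
  have := hV.prob x
  rw [occupation, integral_map (hV.measurable_rescaled T).aemeasurable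
    hφ.aestronglyMeasurable, integral_prod, intervalIntegral.integral_of_le zero_le_one]
  exact Integrable.of_bound (hV.measurable_comp_rescaled hφ T).aestronglyMeasurable M
    (Eventually.of_forall fun p => hM _)

/-- Unique ergodicity: time averages of expectations converge to the invariant average. -/
theorem tendsto_integral_occupation (hV : IsFellerProcess 𝓕 V P)
    (huniq : ∀ μ : Measure S, IsInvariantLaw V P μ → μ = π) (x : S) {φ : S → ℝ}
    (hφ : Continuous φ) :
    Tendsto (fun T => ∫ y, φ y ∂(occupation V P x T)) atTop (𝓝 (∫ y, φ y ∂π)) := by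
  have := hV.isMarkovKernel
  -- Probability measures on a compact metric space form a compact space, so the occupation laws
  -- converge along every ultrafilter; it remains to identify the limit.
  rw [tendsto_iff_ultrafilter]
  intro U hU
  let μ : ℝ → ProbabilityMeasure S := fun T =>
    ⟨occupation V P x T, isProbabilityMeasure_occupation hV x T⟩
  obtain ⟨μ₀, hμ₀⟩ : ∃ μ₀, Tendsto μ U (𝓝 μ₀) := ⟨_, (U.map μ).le_nhds_lim⟩
  rw [ProbabilityMeasure.tendsto_iff_forall_integral_tendsto] at hμ₀
  have hlim : ∀ ψ : S → ℝ, Continuous ψ →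
      Tendsto (fun T => ∫ y, ψ y ∂(occupation V P x T)) U (𝓝 (∫ y, ψ y ∂(μ₀ : Measure S))) :=
    fun ψ hψ => hμ₀ (BoundedContinuousFunction.mkOfCompact ⟨ψ, hψ⟩)
  have hinv : IsInvariantLaw V P (μ₀ : Measure S) := by
    refine ⟨inferInstance, fun t => ?_⟩
    have : IsMarkovKernel (P.map (V t)) := Kernel.IsMarkovKernel.map _ (hV.measurable t)
    refine ext_of_forall_integral_eq_of_IsFiniteMeasure fun ψ => ?_
    have hψm : Measurable ψ := ψ.continuous.measurable
    have hψb : ∀ y, |ψ y| ≤ ‖ψ‖ := fun y => ψ.norm_coe_le_norm y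
    rw [integral_bind_kernel _ _ (Integrable.of_bound hψm.aestronglyMeasurable ‖ψ‖
      (Eventually.of_forall hψb))]
    have hmap : ∀ y, ∫ z, ψ z ∂(P.map (V t) y) = ∫ ω, ψ (V t ω) ∂(P y) := fun y => by
      rw [Kernel.map_apply _ (hV.measurable t),
        integral_map (hV.measurable t).aemeasurable hψm.aestronglyMeasurable]
    simp_rw [hmap]
    -- The Feller property makes `y ↦ E_y[ψ(V_t)]` an admissible test function for weak convergence.
    have l1 := hlim _ (hV.feller t ψ ψ.continuous)
    have l2 := hlim ψ ψ.continuous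
    set m : ℝ → ℝ := fun s => ∫ ω, ψ (V s.toNNReal ω) ∂(P x) with hm
    have hmm : Measurable m := by
      have := (hV.measurable_comp_rescaled hψm 1).stronglyMeasurable.integral_prod_right' (ν := P x)
      simpa using this.measurable
    have hmb : ∀ s, |m s| ≤ ‖ψ‖ := fun s => by
      have := norm_integral_le_of_norm_le_const (μ := P x) (f := fun ω => ψ (V s.toNNReal ω))
        (C := ‖ψ‖) (Eventually.of_forall fun ω => hψb _)
      simpa using this
    have l3 := (tendsto_integral_shift_sub hmm hmb t.coe_nonneg).mono_left hU
    refine eq_of_sub_eq_zero (tendsto_nhds_unique ((l1.sub l2).congr' ?_) l3)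
    filter_upwards [hU (eventually_gt_atTop 0)] with T hT
    rw [integral_occupation hV x T hψm hψb,
      integral_occupation hV x T (M := ‖ψ‖) (hV.feller t ψ ψ.continuous).measurable]
    · congr 1
      -- The Markov property with weight `1` identifies the semigroup applied at time `T * r` with
      -- the expectation at `T * r + t`.
      refine intervalIntegral.integral_congr fun r hr => ?_
      rw [Set.uIcc_of_le zero_le_one] at hr
      have := hV.integral_mul_comp_add x (T * r).toNNReal t (W := fun _ => 1) measurable_const
        (B := 1) (by simp) hψm hψb
      simp only [one_mul] at this
      simp only [hm]
      rw [Real.toNNReal_add (mul_nonneg hT.le hr.1) t.coe_nonneg, Real.toNNReal_coe, this]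
    · intro y
      have := norm_integral_le_of_norm_le_const (μ := P y) (f := fun ω => ψ (V t ω))
        (C := ‖ψ‖) (Eventually.of_forall fun ω => hψb _)
      simpa using this
  rw [← huniq _ hinv]
  exact hlim φ hφ

end Ergodic

/-! ### Mean square ergodic theorem via autocovariances. -/

section Averages

variable {S : Type u} [MetricSpace S] [CompactSpace S] [MeasurableSpace S] [BorelSpace S]
  {Ω : Type v} {mΩ : MeasurableSpace Ω} {𝓕 : Filtration ℝ≥0 mΩ}
  {V : ℝ≥0 → Ω → S} {P : Kernel S Ω} {π : Measure S}

theorem intervalIntegrable_of_bound {E : Type*} [NormedAddCommGroup E] {m : ℝ → E}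
    (hm : AEStronglyMeasurable m volume) {M : ℝ} (hM : ∀ s, ‖m s‖ ≤ M) (a b : ℝ) :
    IntervalIntegrable m volume a b := by
  rw [intervalIntegrable_iff]
  exact Measure.integrableOn_of_bounded (M := M) (by simp) hm (Eventually.of_forall hM)

/-- Fubini for a bounded jointly measurable process over a bounded time interval. -/
theorem integral_intervalIntegral_swap {X : ℝ → Ω → ℝ} {ρ : Measure Ω} [IsProbabilityMeasure ρ]
    (hX : Measurable fun p : ℝ × Ω => X p.1 p.2) {M : ℝ} (hM : ∀ s ω, |X s ω| ≤ M) (a b : ℝ) :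
    ∫ ω, (∫ s in a..b, X s ω) ∂ρ = ∫ s in a..b, ∫ ω, X s ω ∂ρ := by
  refine (intervalIntegral_integral_swap ?_).symm
  have : IsFiniteMeasure (volume.restrict (Set.uIoc a b)) := ⟨by simp⟩
  exact Integrable.of_bound hX.aestronglyMeasurable M (Eventually.of_forall fun p => hM _ _)

/-- Time averages over `[0, b]` of expectations of the accelerated process. -/
theorem tendsto_integral_average (hV : IsFellerProcess 𝓕 V P)
    (huniq : ∀ μ : Measure S, IsInvariantLaw V P μ → μ = π) (x : S) {φ : S → ℝ}
    (hφ : Continuous φ) {b : ℝ} (hb : 0 ≤ b) :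
    Tendsto (fun T : ℝ => ∫ ω, (∫ r in (0 : ℝ)..b, φ (V (T * r).toNNReal ω)) ∂(P x)) atTop
      (𝓝 (b * ∫ y, φ y ∂π)) := by
  have := hV.prob x
  obtain ⟨M, hM⟩ := isCompact_univ.exists_bound_of_continuousOn hφ.continuousOn
  replace hM : ∀ y, |φ y| ≤ M := fun y => hM y trivial
  rcases hb.eq_or_lt with rfl | hb
  · simp
  have h1 := ((tendsto_integral_occupation hV huniq x hφ).comp
    (tendsto_id.atTop_mul_const hb)).const_mul b
  refine h1.congr fun T => ?_
  rw [integral_intervalIntegral_swap (hV.measurable_comp_rescaled hφ.measurable T)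
    (fun _ _ => hM _), Function.comp_apply, integral_occupation hV x _ hφ.measurable hM]
  have := intervalIntegral.integral_comp_mul_left (a := 0) (b := 1)
    (fun r => ∫ ω, φ (V (T * r).toNNReal ω) ∂(P x)) hb.ne'
  simp only [← mul_assoc, mul_zero, mul_one, smul_eq_mul] at this
  simp only [id]
  rw [this, ← mul_assoc, mul_inv_cancel₀ hb.ne', one_mul]

/-- The stationary autocovariance function of `h(V)`. -/
noncomputable def autocov (V : ℝ≥0 → Ω → S) (P : Kernel S Ω) (π : Measure S) (h : S → ℝ)
    (t : ℝ) : ℝ :=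
  ∫ ω, h (V 0 ω) * h (V t.toNNReal ω) ∂(π.bind P)

theorem measurable_autocov (hV : IsFellerProcess 𝓕 V P) (hπ : IsInvariantLaw V P π)
    {h : S → ℝ} (hh : Measurable h) : Measurable (autocov V P π h) := by
  have := hπ.isProbabilityMeasure_bind hV
  have h1 : Measurable fun p : ℝ × Ω => h (V 0 p.2) * h (V (1 * p.1).toNNReal p.2) :=
    (hh.comp ((hV.measurable 0).comp measurable_snd)).mul (hV.measurable_comp_rescaled hh 1)
  have := h1.stronglyMeasurable.integral_prod_right' (ν := π.bind P)
  simp only [one_mul] at this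
  exact this.measurable

theorem abs_mul_le_mul_self {a b M : ℝ} (ha : |a| ≤ M) (hb : |b| ≤ M) : |a * b| ≤ M * M := by
  rw [abs_mul]
  exact mul_le_mul ha hb (abs_nonneg _) ((abs_nonneg _).trans ha)

theorem abs_autocov_le (hV : IsFellerProcess 𝓕 V P) (hπ : IsInvariantLaw V P π)
    {h : S → ℝ} {M : ℝ} (hM : ∀ y, |h y| ≤ M) (t : ℝ) : |autocov V P π h t| ≤ M * M := by
  have := hπ.isProbabilityMeasure_bind hV
  have := norm_integral_le_of_norm_le_const (μ := π.bind P)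
    (f := fun ω => h (V 0 ω) * h (V t.toNNReal ω)) (C := M * M)
    (Eventually.of_forall fun ω => abs_mul_le_mul_self (hM _) (hM _))
  simpa [autocov] using this

theorem integral_mul_eq_autocov (hV : IsFellerProcess 𝓕 V P) (hπ : IsInvariantLaw V P π)
    {h : S → ℝ} (hh : Measurable h) {M : ℝ} (hM : ∀ y, |h y| ≤ M) {s t : ℝ} (hs : 0 ≤ s)
    (hst : s ≤ t) :
    ∫ ω, h (V s.toNNReal ω) * h (V t.toNNReal ω) ∂(π.bind P) = autocov V P π h (t - s) := by
  have h1 := hπ.integral_mul_comp_add hV s.toNNReal (t - s).toNNReal hh hM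
  have h2 := hπ.integral_mul_comp_add hV 0 (t - s).toNNReal hh hM
  rw [← Real.toNNReal_add hs (sub_nonneg.2 hst), add_sub_cancel] at h1
  rw [zero_add] at h2
  rw [h1, autocov, h2]

/-- The averaged autocovariance of a centred continuous observable vanishes. -/
theorem tendsto_integral_autocov (hV : IsFellerProcess 𝓕 V P) (hπ : IsInvariantLaw V P π)
    (huniq : ∀ μ : Measure S, IsInvariantLaw V P μ → μ = π) {h : S → ℝ} (hh : Continuous h)
    (h0 : ∫ y, h y ∂π = 0) {b : ℝ} (hb : 0 ≤ b) :
    Tendsto (fun T : ℝ => ∫ r in (0 : ℝ)..b, autocov V P π h (T * r)) atTop (𝓝 0) := by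
  have := hV.isMarkovKernel
  have := hπ.1
  have := hπ.isProbabilityMeasure_bind hV
  obtain ⟨M, hM⟩ := isCompact_univ.exists_bound_of_continuousOn hh.continuousOn
  replace hM : ∀ y, |h y| ≤ M := fun y => hM y trivial
  have hZb : ∀ T ω, |∫ r in (0 : ℝ)..b, h (V (T * r).toNNReal ω)| ≤ M * b := fun T ω => by
    have := intervalIntegral.norm_integral_le_of_norm_le_const (a := 0) (b := b)
      (f := fun r => h (V (T * r).toNNReal ω)) (C := M) fun s _ => hM _
    simpa [abs_of_nonneg hb] using this
  have hZm : ∀ T, StronglyMeasurable fun ω => ∫ r in (0 : ℝ)..b, h (V (T * r).toNNReal ω) :=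
    fun T => by
      simp only [intervalIntegral.integral_of_le hb]
      exact ((hV.measurable_comp_rescaled hh.measurable T).comp
        measurable_swap).stronglyMeasurable.integral_prod_right'
  -- Conditioning on `V 0 = x` pulls `h x` out; the remaining expectation under `P x` tends
  -- pointwise to `b * ∫ h dπ = 0`.
  have key : ∀ T : ℝ, ∫ r in (0 : ℝ)..b, autocov V P π h (T * r) =
      ∫ x, h x * (∫ ω, (∫ r in (0 : ℝ)..b, h (V (T * r).toNNReal ω)) ∂(P x)) ∂π := by
    intro T
    have hm : Measurable fun p : ℝ × Ω => h (V 0 p.2) * h (V (T * p.1).toNNReal p.2) :=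
      (hh.measurable.comp ((hV.measurable 0).comp measurable_snd)).mul
        (hV.measurable_comp_rescaled hh.measurable T)
    simp only [autocov]
    rw [← integral_intervalIntegral_swap hm (fun _ _ => abs_mul_le_mul_self (hM _) (hM _))]
    simp only [intervalIntegral.integral_const_mul]
    rw [integral_bind_kernel]
    · congr 1
      ext x
      rw [← integral_const_mul]
      refine integral_congr_ae ?_
      filter_upwards [hV.start x] with ω hω
      rw [hω]
    · exact Integrable.bdd_mul (c := M)
        (Integrable.of_bound (hZm T).aestronglyMeasurable (M * b)
          (Eventually.of_forall fun ω => hZb T ω))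
        (hh.measurable.comp (hV.measurable 0)).aestronglyMeasurable
        (Eventually.of_forall fun ω => hM _)
  simp only [key]
  have hlim : (0 : ℝ) = ∫ x, h x * (b * ∫ y, h y ∂π) ∂π := by simp [h0]
  nth_rewrite 2 [hlim]
  refine tendsto_integral_filter_of_dominated_convergence (fun _ => M * (M * b)) ?_ ?_
    (integrable_const _) ?_
  · refine Eventually.of_forall fun T => ?_
    exact (hh.measurable.mul (hZm T).integral_kernel.measurable).aestronglyMeasurable
  · refine Eventually.of_forall fun T => Eventually.of_forall fun x => ?_
    rw [norm_mul]
    refine mul_le_mul (hM x) ?_ (norm_nonneg _) ((abs_nonneg _).trans (hM x))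
    have := norm_integral_le_of_norm_le_const (μ := P x)
      (f := fun ω => ∫ r in (0 : ℝ)..b, h (V (T * r).toNNReal ω)) (C := M * b)
      (Eventually.of_forall fun ω => hZb T ω)
    simpa using this
  · exact Eventually.of_forall fun x => (tendsto_integral_average hV huniq x hh hb).const_mul _

/-- The square expands into a double integral whose integrand depends only on the time gap, by
stationarity. Splitting the inner integral at `r = s` leaves two averaged autocovariances, to which
`tendsto_integral_autocov` applies for each fixed `s`. -/
theorem integral_sq_average (hV : IsFellerProcess 𝓕 V P) (hπ : IsInvariantLaw V P π)
    {h : S → ℝ} (hh : Measurable h) {M : ℝ} (hM : ∀ y, |h y| ≤ M) {T b : ℝ} (hT : 0 ≤ T)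
    (hb : 0 ≤ b) :
    ∫ ω, (∫ r in (0 : ℝ)..b, h (V (T * r).toNNReal ω)) ^ 2 ∂(π.bind P) =
      ∫ s in (0 : ℝ)..b, ((∫ r in (0 : ℝ)..s, autocov V P π h (T * r)) +
        ∫ r in (0 : ℝ)..(b - s), autocov V P π h (T * r)) := by
  have := hπ.isProbabilityMeasure_bind hV
  have hZb : ∀ ω, |∫ r in (0 : ℝ)..b, h (V (T * r).toNNReal ω)| ≤ M * b := fun ω => by
    have := intervalIntegral.norm_integral_le_of_norm_le_const (a := 0) (b := b)
      (f := fun r => h (V (T * r).toNNReal ω)) (C := M) fun s _ => hM _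
    simpa [abs_of_nonneg hb] using this
  have hZm : StronglyMeasurable fun ω => ∫ r in (0 : ℝ)..b, h (V (T * r).toNNReal ω) := by
    simp only [intervalIntegral.integral_of_le hb]
    exact ((hV.measurable_comp_rescaled hh T).comp
      measurable_swap).stronglyMeasurable.integral_prod_right'
  have hVm := hV.measurable_comp_rescaled hh T
  simp only [sq, ← intervalIntegral.integral_mul_const]
  rw [integral_intervalIntegral_swap (X := fun s ω => h (V (T * s).toNNReal ω) *
    ∫ r in (0 : ℝ)..b, h (V (T * r).toNNReal ω)) (M := M * (M * b))]
  rotate_left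
  · exact hVm.mul (hZm.measurable.comp measurable_snd)
  · intro s ω
    rw [abs_mul]
    exact mul_le_mul (hM _) (hZb ω) (abs_nonneg _) ((abs_nonneg _).trans (hM (V 0 ω)))
  refine intervalIntegral.integral_congr fun s hs => ?_
  rw [Set.uIcc_of_le hb] at hs
  simp only [← intervalIntegral.integral_const_mul]
  rw [integral_intervalIntegral_swap (X := fun r ω => h (V (T * s).toNNReal ω) *
    h (V (T * r).toNNReal ω)) ((hh.comp ((hV.measurable _).comp measurable_snd)).mul hVm)
    (fun _ _ => abs_mul_le_mul_self (hM _) (hM _))]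
  have e1 : ∀ r ∈ Set.Icc 0 s, ∫ ω, h (V (T * s).toNNReal ω) * h (V (T * r).toNNReal ω)
      ∂(π.bind P) = autocov V P π h (T * (s - r)) := fun r hr => by
    rw [mul_sub, ← integral_mul_eq_autocov hV hπ hh hM (mul_nonneg hT hr.1)
      (mul_le_mul_of_nonneg_left hr.2 hT)]
    simp only [mul_comm]
  have e2 : ∀ r ∈ Set.Icc s b, ∫ ω, h (V (T * s).toNNReal ω) * h (V (T * r).toNNReal ω)
      ∂(π.bind P) = autocov V P π h (T * (r - s)) := fun r hr => by
    rw [mul_sub, ← integral_mul_eq_autocov hV hπ hh hM (mul_nonneg hT hs.1)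
      (mul_le_mul_of_nonneg_left hr.1 hT)]
  have hm : Measurable fun r : ℝ =>
      ∫ ω, h (V (T * s).toNNReal ω) * h (V (T * r).toNNReal ω) ∂(π.bind P) :=
    (((hh.comp ((hV.measurable _).comp measurable_snd)).mul
      hVm).stronglyMeasurable.integral_prod_right' (ν := π.bind P)).measurable
  have hmb : ∀ r : ℝ,
      ‖∫ ω, h (V (T * s).toNNReal ω) * h (V (T * r).toNNReal ω) ∂(π.bind P)‖ ≤ M * M := fun r => by
    have := norm_integral_le_of_norm_le_const (μ := π.bind P)
      (f := fun ω => h (V (T * s).toNNReal ω) * h (V (T * r).toNNReal ω)) (C := M * M)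
      (Eventually.of_forall fun ω => abs_mul_le_mul_self (hM _) (hM _))
    simpa using this
  have hi := intervalIntegrable_of_bound hm.aestronglyMeasurable hmb
  rw [← intervalIntegral.integral_add_adjacent_intervals (hi 0 s) (hi s b)]
  congr 1
  · rw [intervalIntegral.integral_congr (g := fun r => autocov V P π h (T * (s - r)))]
    · have := intervalIntegral.integral_comp_sub_left (a := 0) (b := s)
        (fun r => autocov V P π h (T * r)) s
      simpa using this
    · intro r hr
      rw [Set.uIcc_of_le hs.1] at hr
      exact e1 r hr
  · rw [intervalIntegral.integral_congr (g := fun r => autocov V P π h (T * (r - s)))]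
    · have := intervalIntegral.integral_comp_sub_right (a := s) (b := b)
        (fun r => autocov V P π h (T * r)) s
      simpa using this
    · intro r hr
      rw [Set.uIcc_of_le hs.2] at hr
      exact e2 r hr

/-- Mean square ergodic theorem for the accelerated stationary process. -/
theorem tendsto_integral_sq_average (hV : IsFellerProcess 𝓕 V P) (hπ : IsInvariantLaw V P π)
    (huniq : ∀ μ : Measure S, IsInvariantLaw V P μ → μ = π) {h : S → ℝ} (hh : Continuous h)
    (h0 : ∫ y, h y ∂π = 0) {b : ℝ} (hb : 0 ≤ b) :
    Tendsto (fun T : ℝ => ∫ ω, (∫ r in (0 : ℝ)..b, h (V (T * r).toNNReal ω)) ^ 2 ∂(π.bind P))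
      atTop (𝓝 0) := by
  obtain ⟨M, hM⟩ := isCompact_univ.exists_bound_of_continuousOn hh.continuousOn
  replace hM : ∀ y, |h y| ≤ M := fun y => hM y trivial
  have hcm : ∀ T, AEStronglyMeasurable (fun r => autocov V P π h (T * r)) volume := fun T =>
    ((measurable_autocov hV hπ hh.measurable).comp (measurable_const_mul T)).aestronglyMeasurable
  have hcont : ∀ T, Continuous fun s => ∫ r in (0 : ℝ)..s, autocov V P π h (T * r) := fun T =>
    intervalIntegral.continuous_primitive (fun a c => intervalIntegrable_of_bound (hcm T)
      (fun s => abs_autocov_le hV hπ hM _) a c) 0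
  have hbd : ∀ T, ∀ s ∈ Set.Icc 0 b, ‖∫ r in (0 : ℝ)..s, autocov V P π h (T * r)‖ ≤ M * M * b :=
    fun T s hs => by
      have := intervalIntegral.norm_integral_le_of_norm_le_const (a := 0) (b := s)
        (f := fun r => autocov V P π h (T * r)) (C := M * M) fun r _ => abs_autocov_le hV hπ hM _
      rw [sub_zero, abs_of_nonneg hs.1] at this
      exact this.trans (mul_le_mul_of_nonneg_left hs.2 (mul_self_nonneg M))
  have hlim : Tendsto (fun T : ℝ => ∫ s in (0 : ℝ)..b,
      ((∫ r in (0 : ℝ)..s, autocov V P π h (T * r)) +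
        ∫ r in (0 : ℝ)..(b - s), autocov V P π h (T * r))) atTop
      (𝓝 (∫ _ in (0 : ℝ)..b, (0 : ℝ))) := by
    refine intervalIntegral.tendsto_integral_filter_of_dominated_convergence
      (fun _ => M * M * b + M * M * b) ?_ ?_ intervalIntegrable_const ?_
    · refine Eventually.of_forall fun T => Continuous.aestronglyMeasurable ?_
      exact (hcont T).add ((hcont T).comp (continuous_const.sub continuous_id))
    · refine Eventually.of_forall fun T => Eventually.of_forall fun s hs => ?_
      rw [Set.uIoc_of_le hb] at hs
      exact norm_add_le_of_le (hbd T s ⟨hs.1.le, hs.2⟩)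
        (hbd T (b - s) ⟨sub_nonneg.2 hs.2, by linarith [hs.1]⟩)
    · refine Eventually.of_forall fun s hs => ?_
      rw [Set.uIoc_of_le hb] at hs
      simpa using (tendsto_integral_autocov hV hπ huniq hh h0 hs.1.le).add
        (tendsto_integral_autocov hV hπ huniq hh h0 (sub_nonneg.2 hs.2))
  rw [intervalIntegral.integral_zero] at hlim
  refine hlim.congr' ?_
  filter_upwards [eventually_ge_atTop 0] with T hT
  exact (integral_sq_average hV hπ hh.measurable hM hT hb).symm

end Averages

/-! ### Vector observables, Gronwall, and deterministic comparison of flows. -/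

section Comparison

variable {S : Type u} [MetricSpace S] [CompactSpace S] [MeasurableSpace S] [BorelSpace S]
  {Ω : Type v} {mΩ : MeasurableSpace Ω} {𝓕 : Filtration ℝ≥0 mΩ}
  {V : ℝ≥0 → Ω → S} {P : Kernel S Ω} {π : Measure S} {K : ℕ}

theorem sq_integral_le_integral_sq {ρ : Measure Ω} [IsProbabilityMeasure ρ] {X : Ω → ℝ}
    (h1 : Integrable X ρ) (h2 : Integrable (fun ω => X ω ^ 2) ρ) :
    (∫ ω, X ω ∂ρ) ^ 2 ≤ ∫ ω, X ω ^ 2 ∂ρ := by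
  set a := ∫ ω, X ω ∂ρ with ha
  have h3 : ∫ ω, (X ω - a) ^ 2 ∂ρ = (∫ ω, X ω ^ 2 ∂ρ) - a ^ 2 := by
    have : ∀ ω, (X ω - a) ^ 2 = X ω ^ 2 - 2 * a * X ω + a ^ 2 := fun ω => by ring
    simp only [this]
    have h4 : Integrable (fun ω => X ω ^ 2 - 2 * a * X ω) ρ := h2.sub (h1.const_mul _)
    rw [integral_add h4 (integrable_const _),
      integral_sub h2 (h1.const_mul _), integral_const_mul, ← ha]
    simp
    ring
  have h4 : 0 ≤ ∫ ω, (X ω - a) ^ 2 ∂ρ := integral_nonneg fun ω => sq_nonneg _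
  linarith

/-- Mean ergodic theorem for a continuous vector valued observable. -/
theorem tendsto_integral_norm_average (hV : IsFellerProcess 𝓕 V P) (hπ : IsInvariantLaw V P π)
    (huniq : ∀ μ : Measure S, IsInvariantLaw V P μ → μ = π)
    {G : S → EuclideanSpace ℝ (Fin K)} (hG : Continuous G) {b : ℝ} (hb : 0 ≤ b) :
    (∀ T, Integrable (fun ω =>
      ‖∫ r in (0 : ℝ)..b, (G (V (T * r).toNNReal ω) - ∫ y, G y ∂π)‖) (π.bind P)) ∧
    Tendsto (fun T : ℝ => ∫ ω,
      ‖∫ r in (0 : ℝ)..b, (G (V (T * r).toNNReal ω) - ∫ y, G y ∂π)‖ ∂(π.bind P))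
      atTop (𝓝 0) := by
  have := hπ.1
  have := hπ.isProbabilityMeasure_bind hV
  set H : S → EuclideanSpace ℝ (Fin K) := fun y => G y - ∫ y, G y ∂π with hHdef
  have hH : Continuous H := hG.sub continuous_const
  obtain ⟨M, hM⟩ := isCompact_univ.exists_bound_of_continuousOn hH.continuousOn
  replace hM : ∀ y, ‖H y‖ ≤ M := fun y => hM y trivial
  have hGi : Integrable G π := by
    obtain ⟨B, hB⟩ := isCompact_univ.exists_bound_of_continuousOn hG.continuousOn
    exact Integrable.of_bound hG.aestronglyMeasurable B
      (Eventually.of_forall fun y => hB y trivial)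
  have hHi : Integrable H π := hGi.sub (integrable_const _)
  have hH0 : ∀ i, ∫ y, H y i ∂π = 0 := fun i => by
    have h1 := (EuclideanSpace.proj (𝕜 := ℝ) i).integral_comp_comm hHi
    have h2 : ∫ y, H y ∂π = 0 := by
      simp only [hHdef]
      rw [integral_sub hGi (integrable_const _)]
      simp
    rw [h2] at h1
    simpa using h1
  set Y : ℝ → Ω → EuclideanSpace ℝ (Fin K) :=
    fun T ω => ∫ r in (0 : ℝ)..b, H (V (T * r).toNNReal ω) with hY
  have hHm : ∀ T, Measurable fun p : ℝ × Ω => H (V (T * p.1).toNNReal p.2) := fun T =>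
    hH.measurable.comp (hV.measurable_rescaled T)
  have hYm : ∀ T, StronglyMeasurable (Y T) := fun T => by
    simp only [hY, intervalIntegral.integral_of_le hb]
    exact ((hHm T).comp measurable_swap).stronglyMeasurable.integral_prod_right'
  have hYb : ∀ T ω, ‖Y T ω‖ ≤ M * b := fun T ω => by
    have := intervalIntegral.norm_integral_le_of_norm_le_const (a := 0) (b := b)
      (f := fun r => H (V (T * r).toNNReal ω)) (C := M) fun s _ => hM _
    simpa [abs_of_nonneg hb] using this
  have hYi : ∀ T ω i, Y T ω i = ∫ r in (0 : ℝ)..b, H (V (T * r).toNNReal ω) i := fun T ω i => by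
    refine ((EuclideanSpace.proj (𝕜 := ℝ) i).intervalIntegral_comp_comm ?_).symm
    exact intervalIntegrable_of_bound
      ((hHm T).comp measurable_prodMk_right).aestronglyMeasurable (fun r => hM _) _ _
  have hinteg1 : ∀ T, Integrable (fun ω => ‖Y T ω‖) (π.bind P) := fun T =>
    Integrable.of_bound (hYm T).norm.aestronglyMeasurable (M * b)
      (Eventually.of_forall fun ω => by simpa using hYb T ω)
  refine ⟨hinteg1, ?_⟩
  have hinteg2 : ∀ T, Integrable (fun ω => ‖Y T ω‖ ^ 2) (π.bind P) := fun T =>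
    Integrable.of_bound ((hYm T).norm.pow 2).aestronglyMeasurable ((M * b) ^ 2)
      (Eventually.of_forall fun ω => by
        rw [Real.norm_of_nonneg (by positivity)]
        exact pow_le_pow_left₀ (norm_nonneg _) (hYb T ω) 2)
  -- The scalar mean square theorem is applied to each coordinate and summed; Cauchy–Schwarz then
  -- passes from the second moment to the first.
  have hsq : Tendsto (fun T => ∫ ω, ‖Y T ω‖ ^ 2 ∂(π.bind P)) atTop (𝓝 0) := by
    have hi : ∀ i, Continuous fun y => H y i := fun i =>
      (EuclideanSpace.proj (𝕜 := ℝ) i).continuous.comp hH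
    have h1 := tendsto_finsetSum Finset.univ fun i (_ : i ∈ Finset.univ) =>
      tendsto_integral_sq_average hV hπ huniq (hi i) (hH0 i) hb
    simp only [Finset.sum_const_zero] at h1
    refine h1.congr fun T => ?_
    simp only [EuclideanSpace.norm_sq_eq, ← hYi, Real.norm_eq_abs, sq_abs]
    rw [integral_finsetSum]
    intro i _
    refine (hinteg2 T).mono' ?_ (Eventually.of_forall fun ω => ?_)
    · exact (((EuclideanSpace.proj (𝕜 := ℝ) i).continuous.comp_stronglyMeasurable
        (hYm T)).pow 2).aestronglyMeasurable
    · rw [norm_pow]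
      exact pow_le_pow_left₀ (norm_nonneg _) (PiLp.norm_apply_le _ i) 2
  have hsqrt := hsq.sqrt
  rw [Real.sqrt_zero] at hsqrt
  exact squeeze_zero (fun T => integral_nonneg fun ω => norm_nonneg _)
    (fun T => Real.le_sqrt_of_sq_le (sq_integral_le_integral_sq (hinteg1 T) (hinteg2 T))) hsqrt

/-- Gronwall in integral form: multiplied by `exp (-(L * t))`, the right-hand side of the hypothesis
has nonpositive derivative, hence never exceeds its initial value `r`. -/
theorem le_mul_exp_of_le_add_integral {w : ℝ → ℝ} (hw : Continuous w) {r L τ : ℝ} (hL : 0 ≤ L)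
    (h : ∀ t ∈ Set.Icc 0 τ, w t ≤ r + L * ∫ s in (0 : ℝ)..t, w s) :
    ∀ t ∈ Set.Icc 0 τ, w t ≤ r * Real.exp (L * t) := by
  intro t ht
  set q : ℝ → ℝ := fun t => Real.exp (-(L * t)) * (r + L * ∫ s in (0 : ℝ)..t, w s) with hq
  have hd : ∀ t, HasDerivAt q (Real.exp (-(L * t)) * L *
      (w t - (r + L * ∫ s in (0 : ℝ)..t, w s))) t := fun t => by
    have h1 : HasDerivAt (fun t => r + L * ∫ s in (0 : ℝ)..t, w s) (L * w t) t :=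
      ((hw.integral_hasStrictDerivAt 0 t).hasDerivAt.const_mul L).const_add r
    have h2 : HasDerivAt (fun t => Real.exp (-(L * t))) (Real.exp (-(L * t)) * (-(L * 1))) t :=
      ((hasDerivAt_id t).const_mul L).neg.exp
    exact (h2.mul h1).congr_deriv (by ring)
  have hanti : AntitoneOn q (Set.Icc 0 τ) := by
    refine antitoneOn_of_deriv_nonpos (convex_Icc 0 τ)
      (fun t _ => (hd t).continuousAt.continuousWithinAt)
      (fun t _ => (hd t).differentiableAt.differentiableWithinAt) fun t ht => ?_
    rw [(hd t).deriv]
    exact mul_nonpos_of_nonneg_of_nonpos (by positivity)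
      (sub_nonpos.2 (h t (interior_subset ht)))
  have h0 := hanti ⟨le_rfl, ht.1.trans ht.2⟩ ht ht.1
  simp only [hq, mul_zero, neg_zero, Real.exp_zero, intervalIntegral.integral_same, add_zero,
    one_mul] at h0
  refine (h t ht).trans ?_
  rw [Real.exp_neg, inv_mul_le_iff₀ (Real.exp_pos _)] at h0
  linarith

/-- A time-integral along a continuous path is controlled by time-integrals along frozen values
of the path on a uniform grid. -/
theorem norm_integral_le_sum_grid {E : Type*} [NormedAddCommGroup E] [NormedSpace ℝ E]
    {D : ℝ → E → E} {c : ℝ → E} {L B η τ : ℝ} {N : ℕ} (hN : 0 < N) (hτ : 0 < τ) (hL : 0 ≤ L)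
    (hη : 0 ≤ η)
    (hD : ∀ x a b, IntervalIntegrable (fun s => D s x) volume a b)
    (hDc : ∀ a b, IntervalIntegrable (fun s => D s (c s)) volume a b)
    (hLip : ∀ s x x', ‖D s x - D s x'‖ ≤ L * ‖x - x'‖)
    (hB : ∀ s ∈ Set.Icc 0 τ, ‖D s (c s)‖ ≤ B)
    (hosc : ∀ k < N, ∀ s ∈ Set.Icc (k * (τ / N)) ((k + 1) * (τ / N)),
      ‖c s - c (k * (τ / N))‖ ≤ η) {t : ℝ} (ht : t ∈ Set.Icc 0 τ) :
    ‖∫ s in (0 : ℝ)..t, D s (c s)‖ ≤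
      (∑ k ∈ Finset.range N, (‖∫ s in (0 : ℝ)..((k + 1) * (τ / N)), D s (c (k * (τ / N)))‖ +
        ‖∫ s in (0 : ℝ)..(k * (τ / N)), D s (c (k * (τ / N)))‖)) + L * η * τ + B * (τ / N) := by
  set δ : ℝ := τ / N with hδ
  have hN' : (0 : ℝ) < N := by exact_mod_cast hN
  have hδ0 : 0 < δ := div_pos hτ hN'
  have hNδ : N * δ = τ := by rw [hδ]; field_simp
  -- Each cell integral is a difference of two integrals from `0`, because the ergodic theorem is
  -- available for windows starting at `0`.
  set J : ℕ → ℝ := fun k => ‖∫ s in (0 : ℝ)..((k + 1) * δ), D s (c (k * δ))‖ +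
    ‖∫ s in (0 : ℝ)..(k * δ), D s (c (k * δ))‖ with hJ
  have hJ0 : ∀ k, 0 ≤ J k := fun k => by positivity
  have grid : ∀ k ≤ N, ‖∫ s in (0 : ℝ)..(k * δ), D s (c s)‖ ≤
      (∑ j ∈ Finset.range k, J j) + L * η * (k * δ) := by
    intro k
    induction k with
    | zero => simp
    | succ k ih =>
      intro hk
      have ih' := ih (by omega)
      have e1 : ∫ s in (0 : ℝ)..((k + 1 : ℕ) * δ), D s (c s) =
          (∫ s in (0 : ℝ)..(k * δ), D s (c s)) +
          ((∫ s in (0 : ℝ)..((k + 1) * δ), D s (c (k * δ))) -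
            (∫ s in (0 : ℝ)..(k * δ), D s (c (k * δ)))) +
          ∫ s in (k * δ)..((k + 1) * δ), (D s (c s) - D s (c (k * δ))) := by
        rw [intervalIntegral.integral_sub (hDc _ _) (hD _ _ _),
          intervalIntegral.integral_interval_sub_left (hD _ _ _) (hD _ _ _), Nat.cast_succ,
          ← intervalIntegral.integral_add_adjacent_intervals (hDc 0 (k * δ))
            (hDc (k * δ) ((k + 1) * δ))]
        abel
      have e2 : ‖∫ s in (k * δ)..((k + 1) * δ), (D s (c s) - D s (c (k * δ)))‖ ≤ L * η * δ := by
        have h1 := intervalIntegral.norm_integral_le_of_norm_le_const (a := k * δ)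
          (b := (k + 1) * δ) (f := fun s => D s (c s) - D s (c (k * δ))) (C := L * η)
          fun s hs => ?_
        · rwa [show (k + 1) * δ - k * δ = δ by ring, abs_of_pos hδ0] at h1
        · rw [Set.uIoc_of_le (by nlinarith)] at hs
          exact (hLip _ _ _).trans
            (mul_le_mul_of_nonneg_left (hosc k (by omega) s ⟨hs.1.le, hs.2⟩) hL)
      rw [e1, Finset.sum_range_succ, Nat.cast_succ]
      have e3 := norm_sub_le (∫ s in (0 : ℝ)..((k + 1) * δ), D s (c (k * δ)))
        (∫ s in (0 : ℝ)..(k * δ), D s (c (k * δ)))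
      refine (norm_add₃_le ..).trans ?_
      have : J k = ‖∫ s in (0 : ℝ)..((k + 1) * δ), D s (c (k * δ))‖ +
        ‖∫ s in (0 : ℝ)..(k * δ), D s (c (k * δ))‖ := rfl
      linarith
  -- The last, incomplete cell is not frozen: its length is at most `δ`, which costs `B * δ`. At `t
  -- = τ` one has `k = N`.
  set k := ⌊t / δ⌋₊ with hk
  have hk1 : k * δ ≤ t := by
    rw [← le_div_iff₀ hδ0]
    exact Nat.floor_le (div_nonneg ht.1 hδ0.le)
  have hk2 : t ≤ (k + 1) * δ := by
    rw [← div_le_iff₀ hδ0]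
    exact (Nat.lt_floor_add_one _).le
  have hkN : k ≤ N := by
    refine Nat.floor_le_of_le ?_
    rw [div_le_iff₀ hδ0, hNδ]
    exact ht.2
  have h1 := grid k hkN
  have h2 : ‖∫ s in (k * δ)..t, D s (c s)‖ ≤ B * δ := by
    have hB0 : 0 ≤ B := (norm_nonneg _).trans (hB 0 ⟨le_rfl, hτ.le⟩)
    have h3 := intervalIntegral.norm_integral_le_of_norm_le_const (a := k * δ) (b := t)
      (f := fun s => D s (c s)) (C := B) fun s hs => ?_
    · rw [abs_of_nonneg (by linarith)] at h3
      exact h3.trans (mul_le_mul_of_nonneg_left (by linarith) hB0)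
    · rw [Set.uIoc_of_le hk1] at hs
      have : 0 ≤ k * δ := by positivity
      exact hB s ⟨by linarith [hs.1], by linarith [hs.2, ht.2]⟩
  rw [← intervalIntegral.integral_add_adjacent_intervals (hDc 0 (k * δ)) (hDc (k * δ) t)]
  have h3 : ∑ j ∈ Finset.range k, J j ≤ ∑ j ∈ Finset.range N, J j :=
    Finset.sum_le_sum_of_subset_of_nonneg (Finset.range_mono hkN) fun j _ _ => hJ0 j
  have h4 : L * η * (k * δ) ≤ L * η * τ :=
    mul_le_mul_of_nonneg_left (hk1.trans ht.2) (mul_nonneg hL hη)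
  exact (norm_add_le _ _).trans (by linarith)

/-- The right-hand side of the flow along a bounded measurable path is integrable. -/
theorem intervalIntegrable_comp_path {E : Type*} [NormedAddCommGroup E] [ProperSpace E]
    [MeasurableSpace E] [BorelSpace E]
    {g : E → S → E} (hg : Continuous fun p : E × S => g p.1 p.2) {c : ℝ → E} (hc : Measurable c)
    {v : ℝ → S} (hv : Measurable v) {a b B : ℝ} (hB : ∀ s ∈ Set.uIoc a b, ‖c s‖ ≤ B) :
    IntervalIntegrable (fun s => g (c s) (v s)) volume a b := by
  obtain ⟨M, hM⟩ := ((isCompact_closedBall (0 : E) B).prod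
    (isCompact_univ (X := S))).exists_bound_of_continuousOn hg.continuousOn
  rw [intervalIntegrable_iff]
  refine Measure.integrableOn_of_bounded (M := M) (by simp)
    (hg.measurable.comp (hc.prodMk hv)).aestronglyMeasurable ?_
  refine (ae_restrict_iff' measurableSet_uIoc).2 (Eventually.of_forall fun s hs => ?_)
  exact hM (c s, v s) ⟨by simpa using hB s hs, trivial⟩

theorem intervalIntegrable_comp_continuous {E : Type*} [NormedAddCommGroup E] [ProperSpace E]
    [MeasurableSpace E] [BorelSpace E]
    {g : E → S → E} (hg : Continuous fun p : E × S => g p.1 p.2) {c : ℝ → E} (hc : Continuous c)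
    {v : ℝ → S} (hv : Measurable v) (a b : ℝ) :
    IntervalIntegrable (fun s => g (c s) (v s)) volume a b := by
  obtain ⟨B, hB⟩ := (isCompact_uIcc (a := a) (b := b)).exists_bound_of_continuousOn hc.continuousOn
  exact intervalIntegrable_comp_path hg hc.measurable hv fun s hs =>
    hB s (Set.uIoc_subset_uIcc hs)

/-- The averaged vector field is Lipschitz. -/
theorem norm_integral_sub_integral_le {E : Type*} [NormedAddCommGroup E] [NormedSpace ℝ E]
    [IsProbabilityMeasure π] {g : E → S → E} {L : ℝ≥0} (hL : ∀ y, LipschitzWith L fun x => g x y)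
    (hi : ∀ x, Integrable (g x) π) (x x' : E) :
    ‖(∫ y, g x y ∂π) - ∫ y, g x' y ∂π‖ ≤ L * ‖x - x'‖ := by
  rw [← integral_sub (hi x) (hi x')]
  have := norm_integral_le_of_norm_le_const (μ := π) (f := fun y => g x y - g x' y)
    (C := L * ‖x - x'‖) (Eventually.of_forall fun y => by
      simpa [dist_eq_norm] using (hL y).dist_le_mul x x')
  simpa using this

/-- Deterministic comparison of a driven flow with the averaged flow. -/
theorem norm_sub_le_of_solutions {E : Type*} [NormedAddCommGroup E] [NormedSpace ℝ E]
    {g : ℝ → E → E} {gbar : E → E} {L : ℝ} (hL : 0 ≤ L)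
    (hLip : ∀ s x x', ‖g s x - g s x'‖ ≤ L * ‖x - x'‖)
    {c z : ℝ → E} (hc : Continuous c) (hz : Continuous z)
    (hgc : ∀ a b, IntervalIntegrable (fun s => g s (c s)) volume a b)
    (hgz : ∀ a b, IntervalIntegrable (fun s => g s (z s)) volume a b)
    (hgb : ∀ a b, IntervalIntegrable (fun s => gbar (z s)) volume a b) {x₀ : E} {τ r : ℝ}
    (hcs : ∀ t, 0 ≤ t → c t = x₀ - ∫ s in (0 : ℝ)..t, g s (c s))
    (hzs : ∀ t, 0 ≤ t → z t = x₀ - ∫ s in (0 : ℝ)..t, gbar (z s))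
    (hr : ∀ t ∈ Set.Icc 0 τ, ‖∫ s in (0 : ℝ)..t, (g s (z s) - gbar (z s))‖ ≤ r) :
    ∀ t ∈ Set.Icc 0 τ, ‖c t - z t‖ ≤ r * Real.exp (L * τ) := by
  intro t ht
  have hr0 : 0 ≤ r := (norm_nonneg _).trans (hr t ht)
  have hw : Continuous fun t => ‖c t - z t‖ := (hc.sub hz).norm
  refine (le_mul_exp_of_le_add_integral hw hL (r := r) (τ := τ) ?_ t ht).trans ?_
  · intro t ht
    -- The averaging error is evaluated along `z` rather than `c`; as `z` is deterministic in the
    -- application, the frozen points will not be random.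
    have e : c t - z t = -(∫ s in (0 : ℝ)..t, (g s (z s) - gbar (z s))) -
        ∫ s in (0 : ℝ)..t, (g s (c s) - g s (z s)) := by
      rw [hcs t ht.1, hzs t ht.1, intervalIntegral.integral_sub (hgz _ _) (hgb _ _),
        intervalIntegral.integral_sub (hgc _ _) (hgz _ _)]
      abel
    have h2 : ‖∫ s in (0 : ℝ)..t, (g s (c s) - g s (z s))‖ ≤
        ∫ s in (0 : ℝ)..t, L * ‖c s - z s‖ :=
      intervalIntegral.norm_integral_le_of_norm_le ht.1
        (Eventually.of_forall fun s _ => hLip s _ _) ((hw.const_mul L).intervalIntegrable _ _)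
    rw [intervalIntegral.integral_const_mul] at h2
    rw [e]
    refine (norm_sub_le _ _).trans ?_
    rw [norm_neg]
    exact add_le_add (hr t ht) h2
  · exact mul_le_mul_of_nonneg_left
      (Real.exp_le_exp.2 (mul_le_mul_of_nonneg_left ht.2 hL)) hr0

end Comparison

/-! ### Borel structure and the metric of path space. -/

section PathSpace

/-- A random continuous path is Borel measurable for the compact-open topology as soon as its
evaluations are measurable. -/
theorem measurable_borel_of_measurable_eval {α E Ω : Type*} [TopologicalSpace α]
    [TopologicalSpace.PseudoMetrizableSpace α]
    [SecondCountableTopology α] [LocallyCompactSpace α] [MetricSpace E]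
    [SecondCountableTopology E] [MeasurableSpace E] [BorelSpace E] [MeasurableSpace Ω]
    {X : Ω → C(α, E)} (hX : ∀ t, Measurable fun ω => X ω t) :
    @Measurable Ω C(α, E) _ (borel _) X := by
  rw [borel_eq_generateFrom_of_subbasis (ContinuousMap.compactOpen_eq (X := α) (Y := E))]
  refine measurable_generateFrom ?_
  rintro _ ⟨A, hA, U, hU, rfl⟩
  change IsCompact A at hA
  change IsOpen U at hU
  -- `Metric.infDist` to the empty set is `0`, so `U = univ` needs its own case.
  rcases Set.eq_empty_or_nonempty Uᶜ with hUe | hUne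
  · rw [Set.compl_empty_iff] at hUe
    simp [hUe]
  obtain ⟨D, hDA, hDc, hD⟩ :=
    (TopologicalSpace.IsSeparable.of_separableSpace A).exists_countable_dense_subset
  -- On a compact set, staying in `U` means keeping a uniform positive distance from `Uᶜ`; by
  -- continuity a countable dense subset suffices to test this.
  have key : Set.preimage X {f : C(α, E) | Set.MapsTo f A U} =
      ⋃ n : ℕ, ⋂ q ∈ D, {ω | 1 / ((n : ℝ) + 1) ≤ Metric.infDist (X ω q) Uᶜ} := by
    ext ω
    simp only [Set.mem_preimage, Set.mem_ofPred_eq, Set.mem_iUnion, Set.mem_iInter]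
    have hcont : Continuous fun q => Metric.infDist (X ω q) Uᶜ :=
      (Metric.continuous_infDist_pt _).comp (X ω).continuous
    constructor
    · intro hm
      rcases A.eq_empty_or_nonempty with rfl | hAne
      · exact ⟨0, fun q hq => absurd (hDA hq) (Set.notMem_empty q)⟩
      obtain ⟨q₀, hq₀, hmin⟩ := hA.exists_isMinOn hAne hcont.continuousOn
      have hpos : 0 < Metric.infDist (X ω q₀) Uᶜ :=
        (hU.isClosed_compl.notMem_iff_infDist_pos hUne).1 (by simpa using hm hq₀)
      obtain ⟨n, hn⟩ := exists_nat_one_div_lt hpos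
      exact ⟨n, fun q hq => hn.le.trans (hmin (hDA hq))⟩
    · rintro ⟨n, hn⟩ q hq
      have hcl : IsClosed {q | 1 / ((n : ℝ) + 1) ≤ Metric.infDist (X ω q) Uᶜ} :=
        isClosed_le continuous_const hcont
      have hq' : 1 / ((n : ℝ) + 1) ≤ Metric.infDist (X ω q) Uᶜ :=
        closure_minimal (s := D) (fun q hq => hn q hq) hcl (hD hq)
      have hpos : 0 < Metric.infDist (X ω q) Uᶜ := lt_of_lt_of_le (by positivity) hq'
      simpa using (hU.isClosed_compl.notMem_iff_infDist_pos hUne).2 hpos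
  rw [key]
  refine MeasurableSet.iUnion fun n => MeasurableSet.biInter hDc fun q _ => ?_
  exact measurableSet_le measurable_const ((Metric.continuous_infDist_pt _).measurable.comp (hX q))

variable {K : ℕ}

/-- The integral is cut at `τ`: before it the supremum is at most `r` and the weight has mass at
most `1`; after it the truncation at `1` leaves the tail `exp (-τ)`. -/
theorem pathDist_le {φ ψ : C(ℝ≥0, EuclideanSpace ℝ (Fin K))} {r τ : ℝ} (hr : 0 ≤ r) (hτ : 0 ≤ τ)
    (h : ∀ s : ℝ≥0, (s : ℝ) ≤ τ → ‖φ s - ψ s‖ ≤ r) : pathDist φ ψ ≤ r + Real.exp (-τ) := by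
  have hi1 : IntegrableOn (fun t : ℝ => Real.exp (-t)) (Set.Ioi 0) := by
    simpa using exp_neg_integrableOn_Ioi 0 one_pos
  have hi2 : IntegrableOn (fun t : ℝ => Real.exp (-t)) (Set.Ioi τ) :=
    hi1.mono_set (Set.Ioi_subset_Ioi hτ)
  have hi3 : IntegrableOn ((Set.Ioi τ).indicator fun t : ℝ => Real.exp (-t)) (Set.Ioi 0) :=
    ((integrable_indicator_iff measurableSet_Ioi).2 hi2).integrableOn
  have hval : ∫ t in Set.Ioi (0 : ℝ), (Real.exp (-t) * r +
      (Set.Ioi τ).indicator (fun t : ℝ => Real.exp (-t)) t) = r + Real.exp (-τ) := by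
    rw [integral_add (hi1.mul_const r) hi3, integral_mul_const, integral_exp_neg_Ioi_zero,
      one_mul, setIntegral_indicator measurableSet_Ioi,
      Set.inter_eq_self_of_subset_right (Set.Ioi_subset_Ioi hτ), integral_exp_neg_Ioi]
  rw [← hval, pathDist]
  -- Only the majorant has to be integrable, so measurability of the running supremum is not needed.
  refine integral_mono_of_nonneg (Eventually.of_forall fun t => ?_) ((hi1.mul_const r).add hi3)
    ((ae_restrict_iff' measurableSet_Ioi).2 (Eventually.of_forall fun t ht => ?_))
  · exact mul_nonneg (Real.exp_pos _).le
      (le_min zero_le_one (Real.iSup_nonneg fun s => norm_nonneg _))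
  · by_cases htτ : τ < t
    · have : (Set.Ioi τ).indicator (fun t : ℝ => Real.exp (-t)) t = Real.exp (-t) :=
        Set.indicator_of_mem htτ _
      simp only [this]
      have h1 : Real.exp (-t) * min 1 (⨆ s : Set.Icc (0 : ℝ≥0) t.toNNReal, ‖φ s - ψ s‖) ≤
          Real.exp (-t) * 1 := mul_le_mul_of_nonneg_left (min_le_left _ _) (Real.exp_pos _).le
      have h2 : 0 ≤ Real.exp (-t) * r := mul_nonneg (Real.exp_pos _).le hr
      linarith
    · have : (Set.Ioi τ).indicator (fun t : ℝ => Real.exp (-t)) t = 0 :=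
        Set.indicator_of_notMem htτ _
      simp only [this, add_zero]
      refine mul_le_mul_of_nonneg_left ((min_le_right _ _).trans ?_) (Real.exp_pos _).le
      refine Real.iSup_le (fun s => h s ?_) hr
      have h1 : (s : ℝ) ≤ (t.toNNReal : ℝ) := NNReal.coe_le_coe.2 s.2.2
      rw [Real.coe_toNNReal t (le_of_lt ht)] at h1
      exact h1.trans (not_lt.1 htτ)

/-- Uniform closeness on one interval `[0, τ]` with small `exp (-τ)` forces small `pathDist`. This
makes `F` Borel for the compact-open topology. -/
theorem PathContinuous.continuous {F : C(ℝ≥0, EuclideanSpace ℝ (Fin K)) → ℝ}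
    (hF : PathContinuous F) : Continuous F := by
  rw [continuous_iff_continuousAt]
  intro φ
  rw [ContinuousAt, Metric.tendsto_nhds]
  intro η hη
  obtain ⟨δ, hδ, h⟩ := hF φ η hη
  obtain ⟨τ, hτ0, hτ⟩ : ∃ τ : ℝ, 0 ≤ τ ∧ Real.exp (-τ) < δ / 2 := by
    have h1 := (Real.tendsto_exp_neg_atTop_nhds_zero.eventually_lt_const (half_pos hδ)).and
      (eventually_ge_atTop 0)
    obtain ⟨τ, h2, h3⟩ := h1.exists
    exact ⟨τ, h3, h2⟩
  have hu := ContinuousMap.tendsto_iff_forall_isCompact_tendstoUniformlyOn.1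
    (tendsto_id (x := 𝓝 φ)) (Set.Icc 0 τ.toNNReal) isCompact_Icc
  rw [Metric.tendstoUniformlyOn_iff] at hu
  filter_upwards [hu (δ / 2) (half_pos hδ)] with ψ hψ
  rw [dist_comm, Real.dist_eq]
  refine h ψ ((pathDist_le (half_pos hδ).le hτ0 fun s hs => ?_).trans_lt (by linarith))
  rw [← dist_eq_norm]
  exact (hψ s ⟨zero_le, NNReal.le_toNNReal_of_coe_le hs⟩).le

end PathSpace

/-! ### Measurability of solutions through Picard iteration. -/

section Picard

variable {S : Type u} [MetricSpace S] [CompactSpace S] [MeasurableSpace S] [BorelSpace S]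
  {Ω : Type v} {mΩ : MeasurableSpace Ω}
  {E : Type*} [NormedAddCommGroup E] [InnerProductSpace ℝ E] [FiniteDimensional ℝ E]
  [MeasurableSpace E] [BorelSpace E]

/-- Picard iterates of the flow driven by the process `q`. -/
noncomputable def picard (g : E → S → E) (x₀ : E) (q : ℝ × Ω → S) : ℕ → ℝ × Ω → E
  | 0 => fun _ => x₀
  | n + 1 => fun p => x₀ - ∫ s, (Set.Ioc 0 p.1).indicator
      (fun s => g (picard g x₀ q n (s, p.2)) (q (s, p.2))) s

variable {g : E → S → E} {x₀ : E} {q : ℝ × Ω → S}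

/-- Writing the iteration as an integral over the whole line against an indicator turns the endpoint
into a parameter, so joint measurability in `(t, ω)` passes through the integral. -/
theorem measurable_picard (hg : Continuous fun p : E × S => g p.1 p.2) (hq : Measurable q)
    (n : ℕ) : Measurable (picard g x₀ q n) := by
  induction n with
  | zero => exact measurable_const
  | succ n ih =>
    have h1 : Measurable fun r : (ℝ × Ω) × ℝ =>
        g (picard g x₀ q n (r.2, r.1.2)) (q (r.2, r.1.2)) := by
      have hp : Measurable fun r : (ℝ × Ω) × ℝ => (r.2, r.1.2) :=
        measurable_snd.prodMk (measurable_snd.comp measurable_fst)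
      exact hg.measurable.comp ((ih.comp hp).prodMk (hq.comp hp))
    have hs : MeasurableSet {r : (ℝ × Ω) × ℝ | 0 < r.2 ∧ r.2 ≤ r.1.1} :=
      (measurableSet_lt measurable_const measurable_snd).inter
        (measurableSet_le measurable_snd (measurable_fst.comp measurable_fst))
    have h2 := (h1.indicator hs).stronglyMeasurable.integral_prod_right' (ν := volume)
    exact measurable_const.sub h2.measurable

/-- Each iteration integrates the previous error times `L`, producing the next term `(L * t) ^ n /
n!`. The solution `c` is given, so no fixed point has to be constructed. -/
theorem norm_picard_sub_le (hg : Continuous fun p : E × S => g p.1 p.2) (hq : Measurable q)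
    {L : ℝ≥0} (hL : ∀ y, LipschitzWith L fun x => g x y) {c : ℝ → E} (hc : Continuous c) {ω : Ω}
    (hcs : ∀ t, 0 ≤ t → c t = x₀ - ∫ s in (0 : ℝ)..t, g (c s) (q (s, ω))) {τ B : ℝ}
    (hB : ∀ t ∈ Set.Icc 0 τ, ‖x₀ - c t‖ ≤ B) (n : ℕ) :
    ∀ t ∈ Set.Icc 0 τ, ‖picard g x₀ q n (t, ω) - c t‖ ≤ B * ((L * t) ^ n / n.factorial) := by
  have hqω : Measurable fun s => q (s, ω) := hq.comp measurable_prodMk_right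
  induction n with
  | zero => intro t ht; simpa [picard] using hB t ht
  | succ n ih =>
    intro t ht
    have hB0 : 0 ≤ B := (norm_nonneg _).trans (hB t ht)
    obtain ⟨M, hM⟩ := (isCompact_Icc (a := 0) (b := τ)).exists_bound_of_continuousOn hc.continuousOn
    have hi : IntervalIntegrable (fun s => g (picard g x₀ q n (s, ω)) (q (s, ω))) volume 0 t := by
      refine intervalIntegrable_comp_path hg ((measurable_picard hg hq n).comp
        measurable_prodMk_right) hqω (B := B * ((L * τ) ^ n / n.factorial) + M) fun s hs => ?_
      rw [Set.uIoc_of_le ht.1] at hs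
      have hs' : s ∈ Set.Icc 0 τ := ⟨hs.1.le, hs.2.trans ht.2⟩
      have h1 := ih s hs'
      have h2 : B * ((L * s) ^ n / n.factorial) ≤ B * ((L * τ) ^ n / n.factorial) := by
        have := hs'.1
        have := hs'.2
        gcongr
      calc ‖picard g x₀ q n (s, ω)‖ = ‖(picard g x₀ q n (s, ω) - c s) + c s‖ := by simp
        _ ≤ _ := (norm_add_le _ _).trans (add_le_add (h1.trans h2) (hM s hs'))
    have e : picard g x₀ q (n + 1) (t, ω) - c t =
        ∫ s in (0 : ℝ)..t, (g (c s) (q (s, ω)) - g (picard g x₀ q n (s, ω)) (q (s, ω))) := by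
      rw [intervalIntegral.integral_sub (intervalIntegrable_comp_continuous hg hc hqω 0 t) hi,
        hcs t ht.1, picard]
      simp only []
      rw [integral_indicator measurableSet_Ioc,
        ← intervalIntegral.integral_of_le ht.1]
      abel
    rw [e]
    have hcont : Continuous fun s : ℝ => L * (B * ((L * s) ^ n / n.factorial)) := by fun_prop
    refine (intervalIntegral.norm_integral_le_of_norm_le ht.1 (Eventually.of_forall fun s hs => ?_)
      (hcont.intervalIntegrable 0 t)).trans_eq ?_
    · have h1 := (hL (q (s, ω))).dist_le_mul (c s) (picard g x₀ q n (s, ω))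
      rw [dist_eq_norm, dist_comm, dist_eq_norm] at h1
      exact h1.trans (mul_le_mul_of_nonneg_left (ih s ⟨hs.1.le, hs.2.trans ht.2⟩) L.coe_nonneg)
    · have : ∀ s : ℝ, L * (B * ((L * s) ^ n / n.factorial)) =
          (L * B * L ^ n / n.factorial) * s ^ n := fun s => by ring
      simp only [this]
      rw [intervalIntegral.integral_const_mul, integral_pow, Nat.factorial_succ]
      push_cast
      field_simp
      ring

theorem tendsto_picard (hg : Continuous fun p : E × S => g p.1 p.2) (hq : Measurable q)
    {L : ℝ≥0} (hL : ∀ y, LipschitzWith L fun x => g x y) {c : ℝ → E} (hc : Continuous c) {ω : Ω}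
    (hcs : ∀ t, 0 ≤ t → c t = x₀ - ∫ s in (0 : ℝ)..t, g (c s) (q (s, ω))) {t : ℝ} (ht : 0 ≤ t) :
    Tendsto (fun n => picard g x₀ q n (t, ω)) atTop (𝓝 (c t)) := by
  obtain ⟨B, hB⟩ := (isCompact_Icc (a := 0) (b := t)).exists_bound_of_continuousOn
    (continuous_const.sub hc : Continuous fun t => x₀ - c t).continuousOn
  rw [tendsto_iff_norm_sub_tendsto_zero]
  have h1 := (FloorSemiring.tendsto_pow_div_factorial_atTop ((L : ℝ) * t)).const_mul B
  rw [mul_zero] at h1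
  exact squeeze_zero (fun n => norm_nonneg _)
    (fun n => norm_picard_sub_le hg hq hL hc hcs hB n t ⟨ht, le_rfl⟩) h1

/-- Continuous functionals of almost sure solutions of the driven flow are measurable. -/
theorem aestronglyMeasurable_comp_solution {ρ : Measure Ω}
    (hg : Continuous fun p : E × S => g p.1 p.2) (hq : Measurable q)
    {L : ℝ≥0} (hL : ∀ y, LipschitzWith L fun x => g x y) {X : Ω → C(ℝ≥0, E)}
    (hX : ∀ᵐ ω ∂ρ, ∀ t : ℝ≥0,
      X ω t = x₀ - ∫ s in (0 : ℝ)..t, g (X ω s.toNNReal) (q (s, ω)))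
    {F : C(ℝ≥0, E) → ℝ} (hF : Continuous F) : AEStronglyMeasurable (fun ω => F (X ω)) ρ := by
  -- The exceptional set need not be measurable; replacing the path by `0` on a measurable null
  -- superset makes the evaluations limits of measurable functions everywhere.
  obtain ⟨A, hAs, hAm, hA0⟩ := exists_measurable_superset_of_null (ae_iff.1 hX)
  classical
  set X' : Ω → C(ℝ≥0, E) := fun ω => if ω ∈ A then ContinuousMap.const _ 0 else X ω with hX'
  have hev : ∀ t, Measurable fun ω => X' ω t := by
    intro t
    refine measurable_of_tendsto_metrizable
      (f := fun n ω => if ω ∈ A then (0 : E) else picard g x₀ q n (t, ω)) (fun n => ?_) ?_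
    · exact Measurable.ite hAm measurable_const
        ((measurable_picard hg hq n).comp measurable_prodMk_left)
    · rw [tendsto_pi_nhds]
      intro ω
      by_cases hω : ω ∈ A
      · simp [hX', hω]
      · have hsol := not_not.1 fun h => hω (hAs h)
        simp only [hX', hω, if_false]
        have := tendsto_picard hg hq hL (c := fun s => X ω s.toNNReal) (by fun_prop) (ω := ω)
          (fun s hs => by simpa [hs] using hsol s.toNNReal) t.coe_nonneg
        simpa using this
  borelize C(ℝ≥0, E)
  have hXm : Measurable X' := measurable_borel_of_measurable_eval hev
  refine ⟨fun ω => F (X' ω), (hF.measurable.comp hXm).stronglyMeasurable, ?_⟩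
  have hA : ∀ᵐ ω ∂ρ, ω ∉ A := measure_eq_zero_iff_ae_notMem.1 hA0
  filter_upwards [hA] with ω hω
  simp [hX', hω]

end Picard

/-! ### The averaging principle. -/

section Averaging

variable {S : Type u} [MetricSpace S] [CompactSpace S] [MeasurableSpace S] [BorelSpace S]
  {Ω : Type v} {mΩ : MeasurableSpace Ω} {𝓕 : Filtration ℝ≥0 mΩ}
  {V : ℝ≥0 → Ω → S} {P : Kernel S Ω} {π : Measure S} {K : ℕ}

/-- Averaging principle: on a bounded time interval the distance of the flow driven by the
accelerated process to the averaged flow is bounded, up to an arbitrarily small constant, by a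
random variable that vanishes in mean. -/
theorem exists_averaging_bound (hV : IsFellerProcess 𝓕 V P) (hπ : IsInvariantLaw V P π)
    (huniq : ∀ μ : Measure S, IsInvariantLaw V P μ → μ = π)
    {g : EuclideanSpace ℝ (Fin K) → S → EuclideanSpace ℝ (Fin K)}
    (hg : Continuous fun p : EuclideanSpace ℝ (Fin K) × S => g p.1 p.2)
    {L : ℝ≥0} (hL : ∀ y, LipschitzWith L fun x => g x y)
    {x₀ : EuclideanSpace ℝ (Fin K)} {z : ℝ → EuclideanSpace ℝ (Fin K)} (hz : Continuous z)
    (hzs : ∀ t, 0 ≤ t → z t = x₀ - ∫ s in (0 : ℝ)..t, ∫ y, g (z s) y ∂π)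
    {τ r : ℝ} (hτ : 0 < τ) (hr : 0 < r) :
    ∃ Y : ℝ → Ω → ℝ, (∀ T ω, 0 ≤ Y T ω) ∧ (∀ T, Integrable (Y T) (π.bind P)) ∧
      Tendsto (fun T => ∫ ω, Y T ω ∂(π.bind P)) atTop (𝓝 0) ∧
      ∀ T ω, ∀ c : ℝ → EuclideanSpace ℝ (Fin K), Continuous c →
        (∀ t, 0 ≤ t → c t = x₀ - ∫ s in (0 : ℝ)..t, g (c s) (V (T * s).toNNReal ω)) →
        ∀ t ∈ Set.Icc 0 τ, ‖c t - z t‖ ≤ (Y T ω + r) * Real.exp (L * τ) := by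
  have := hπ.1
  have hgi : ∀ x, Integrable (g x) π := fun x => by
    have hgx : Continuous (g x) := hg.comp (continuous_const.prodMk continuous_id)
    obtain ⟨B, hB⟩ := isCompact_univ.exists_bound_of_continuousOn hgx.continuousOn
    exact Integrable.of_bound hgx.aestronglyMeasurable B
      (Eventually.of_forall fun y => hB y trivial)
  set gbar : EuclideanSpace ℝ (Fin K) → EuclideanSpace ℝ (Fin K) := fun x => ∫ y, g x y ∂π
    with hgbar
  have hgbarL : ∀ x x', ‖gbar x - gbar x'‖ ≤ L * ‖x - x'‖ := norm_integral_sub_integral_le hL hgi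
  have hgbarc : Continuous gbar :=
    (LipschitzWith.of_dist_le_mul fun x x' => by
      simpa only [dist_eq_norm] using hgbarL x x').continuous
  have hgL : ∀ y x x', ‖g x y - g x' y‖ ≤ L * ‖x - x'‖ := fun y x x' => by
    simpa only [dist_eq_norm] using (hL y).dist_le_mul x x'
  obtain ⟨B, hB⟩ := ((isCompact_Icc (a := 0) (b := τ)).prod
    (isCompact_univ (X := S))).exists_bound_of_continuousOn
    (f := fun p : ℝ × S => g (z p.1) p.2)
    (hg.comp ((hz.comp continuous_fst).prodMk continuous_snd)).continuousOn
  have hBbar : ∀ s ∈ Set.Icc 0 τ, ‖gbar (z s)‖ ≤ B := fun s hs => by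
    have := norm_integral_le_of_norm_le_const (μ := π) (f := fun y => g (z s) y) (C := B)
      (Eventually.of_forall fun y => hB (s, y) ⟨hs, trivial⟩)
    simpa using this
  -- Half of `r` is reserved for freezing `z` on cells, half for the incomplete cell. The `+ 1`
  -- keeps the denominator positive when `L = 0`.
  set η : ℝ := r / (2 * (2 * L * τ + 1)) with hη
  have hden : 0 < 2 * (2 * L * τ + 1) := by positivity
  have hη0 : 0 < η := div_pos hr hden
  have hη2 : 2 * L * η * τ ≤ r / 2 := by
    have h1 : η * (2 * (2 * L * τ + 1)) = r := div_mul_cancel₀ _ hden.ne'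
    nlinarith
  have huc := (isCompact_Icc (a := 0) (b := τ)).uniformContinuousOn_of_continuous hz.continuousOn
  obtain ⟨d, hd0, hd⟩ := Metric.uniformContinuousOn_iff.1 huc η hη0
  obtain ⟨N, hN0, hNd, hNB⟩ : ∃ N : ℕ, 0 < N ∧ τ / N < d ∧ 2 * B * (τ / N) ≤ r / 2 := by
    have h1 : Tendsto (fun N : ℕ => τ / N) atTop (𝓝 0) := tendsto_const_div_atTop_nhds_zero_nat τ
    have h2 := h1.const_mul (2 * B)
    rw [mul_zero] at h2
    obtain ⟨N, h3, h4, h5⟩ := ((eventually_gt_atTop 0).and ((h1.eventually_lt_const hd0).and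
      (h2.eventually_lt_const (half_pos hr)))).exists
    exact ⟨N, h3, h4, h5.le⟩
  set δ : ℝ := τ / N with hδ
  have hN' : (0 : ℝ) < N := by exact_mod_cast hN0
  have hδ0 : 0 < δ := div_pos hτ hN'
  have hNδ : N * δ = τ := by rw [hδ]; field_simp
  set A : EuclideanSpace ℝ (Fin K) → ℝ → ℝ → Ω → ℝ := fun x b T ω =>
    ‖∫ s in (0 : ℝ)..b, (g x (V (T * s).toNNReal ω) - gbar x)‖ with hA
  have hAi : ∀ x b, 0 ≤ b → ∀ T, Integrable (A x b T) (π.bind P) := fun x b hb =>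
    (tendsto_integral_norm_average hV hπ huniq (G := g x)
      (hg.comp (continuous_const.prodMk continuous_id)) hb).1
  have hAt : ∀ x b, 0 ≤ b → Tendsto (fun T => ∫ ω, A x b T ω ∂(π.bind P)) atTop (𝓝 0) :=
    fun x b hb => (tendsto_integral_norm_average hV hπ huniq (G := g x)
      (hg.comp (continuous_const.prodMk continuous_id)) hb).2
  have hk0 : ∀ k : ℕ, (0 : ℝ) ≤ k * δ := fun k => by positivity
  have hk1 : ∀ k : ℕ, (0 : ℝ) ≤ (k + 1) * δ := fun k => by positivity
  -- The bound involves only `z` on the grid and the index path, not `c`, so one integrable variable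
  -- serves every solution.
  refine ⟨fun T ω => ∑ k ∈ Finset.range N,
    (A (z (k * δ)) ((k + 1) * δ) T ω + A (z (k * δ)) (k * δ) T ω),
    fun T ω => Finset.sum_nonneg fun k _ => add_nonneg (norm_nonneg _) (norm_nonneg _),
    fun T => ?_, ?_, ?_⟩
  · exact integrable_finsetSum _ fun k _ =>
      (hAi (z (k * δ)) _ (hk1 k) T).add (hAi (z (k * δ)) _ (hk0 k) T)
  · have h1 := tendsto_finsetSum (Finset.range N) fun (k : ℕ) _ =>
      (hAt (z (k * δ)) _ (hk1 k)).add (hAt (z (k * δ)) _ (hk0 k))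
    simp only [add_zero, Finset.sum_const_zero] at h1
    refine h1.congr fun T => ?_
    refine ((integral_finsetSum _ fun (k : ℕ) _ =>
      (hAi (z (k * δ)) _ (hk1 k) T).add (hAi (z (k * δ)) _ (hk0 k) T)).trans
      (Finset.sum_congr rfl fun k _ => ?_)).symm
    exact integral_add (hAi (z (k * δ)) _ (hk1 k) T) (hAi (z (k * δ)) _ (hk0 k) T)
  · intro T ω c hc hcs
    have hv : Measurable fun s : ℝ => V (T * s).toNNReal ω :=
      (hV.measurable_rescaled T).comp measurable_prodMk_right
    have hgz := intervalIntegrable_comp_continuous hg hz hv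
    have hgb : ∀ a b, IntervalIntegrable (fun s => gbar (z s)) volume a b := fun a b =>
      (hgbarc.comp hz).intervalIntegrable a b
    refine norm_sub_le_of_solutions (g := fun s x => g x (V (T * s).toNNReal ω)) (gbar := gbar)
      L.coe_nonneg (fun s x x' => hgL _ x x') hc hz
      (intervalIntegrable_comp_continuous hg hc hv) hgz hgb hcs hzs fun t ht => ?_
    -- Both `g` and `gbar` are `L`-Lipschitz and bounded by `B` along `z`, so their difference has
    -- constants `2 * L` and `2 * B`.
    have h1 := norm_integral_le_sum_grid (D := fun s x => g x (V (T * s).toNNReal ω) - gbar x)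
      (c := z) (L := 2 * L) (B := 2 * B) (η := η) hN0 hτ (by positivity) hη0.le
      (fun x a b => (intervalIntegrable_comp_continuous hg continuous_const hv a b).sub
        intervalIntegrable_const) (fun a b => (hgz a b).sub (hgb a b)) ?_ ?_ ?_ ht
    · simp only [hA]
      linarith
    · intro s x x'
      have h2 := hgL (V (T * s).toNNReal ω) x x'
      have h3 := hgbarL x x'
      calc _ = ‖(g x (V (T * s).toNNReal ω) - g x' (V (T * s).toNNReal ω)) -
            (gbar x - gbar x')‖ := by congr 1; abel
        _ ≤ _ := (norm_sub_le _ _).trans (by linarith)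
    · intro s hs
      refine (norm_sub_le _ _).trans ?_
      linarith [hB (s, V (T * s).toNNReal ω) ⟨hs, trivial⟩, hBbar s hs]
    · intro k hk s hs
      have hk' : ((k : ℝ) + 1) * δ ≤ τ := by
        rw [← hNδ]
        exact mul_le_mul_of_nonneg_right (by exact_mod_cast hk) hδ0.le
      rw [← dist_eq_norm]
      have hs1 : (k : ℝ) * δ ≤ s := hs.1
      have hs2 : s ≤ ((k : ℝ) + 1) * δ := hs.2
      refine (hd s ⟨(hk0 k).trans hs1, hs2.trans hk'⟩ (k * δ)
        ⟨hk0 k, (hs1.trans hs2).trans hk'⟩ ?_).le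
      rw [Real.dist_eq, abs_of_nonneg (by linarith)]
      linarith

end Averaging

end SGP

/-! ### Weak convergence to the full gradient flow. -/

theorem mainTheorem1 {K : ℕ}
    {S : Type u} [MetricSpace S] [CompactSpace S] [MeasurableSpace S] [BorelSpace S]
    {Ω : Type v} {mΩ : MeasurableSpace Ω} (𝓕 : Filtration ℝ≥0 mΩ)
    (V : ℝ≥0 → Ω → S) (P : Kernel S Ω) (π : Measure S)
    (hV : SGP.IsFellerProcess 𝓕 V P) (hπ : SGP.IndexAssumption.{u, v, w} V P π)
    (f : EuclideanSpace ℝ (Fin K) → S → ℝ) (hf : SGP.TargetAssumption f π)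
    (θ₀ : EuclideanSpace ℝ (Fin K))
    (θ : ℝ → Ω → C(ℝ≥0, EuclideanSpace ℝ (Fin K)))
    (hθ : ∀ ε > 0, ∀ᵐ ω ∂(π.bind P), SGP.SolvesSGPC f ε θ₀ (fun t => V t ω) (θ ε ω))
    (ζ : C(ℝ≥0, EuclideanSpace ℝ (Fin K))) (hζ : SGP.SolvesFullFlow f π θ₀ ζ)
    (F : C(ℝ≥0, EuclideanSpace ℝ (Fin K)) → ℝ)
    (hF_bdd : ∃ M, ∀ φ, |F φ| ≤ M) (hF_cont : SGP.PathContinuous F) :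
    (∀ ε > 0, Integrable (fun ω => F (θ ε ω)) (π.bind P)) ∧
      Tendsto (fun ε => ∫ ω, F (θ ε ω) ∂(π.bind P)) (𝓝[>] 0) (𝓝 (∫ _, F ζ ∂(π.bind P))) ∧
      ∫ _, F ζ ∂(π.bind P) = F ζ := by
  have hprob := hπ.invariant.isProbabilityMeasure_bind hV
  obtain ⟨M, hM⟩ := hF_bdd
  have hM0 : 0 ≤ M := (abs_nonneg _).trans (hM ζ)
  obtain ⟨L, hL⟩ := hf.lipschitz
  set g : EuclideanSpace ℝ (Fin K) → S → EuclideanSpace ℝ (Fin K) :=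
    fun x y => gradient (fun x => f x y) x with hgdef
  have hg : Continuous fun p : EuclideanSpace ℝ (Fin K) × S => g p.1 p.2 := hf.cont_grad
  have hconst : ∫ _, F ζ ∂(π.bind P) = F ζ := by simp
  have hsol : ∀ ε > 0, ∀ᵐ ω ∂(π.bind P), ∀ t : ℝ≥0, θ ε ω t =
      θ₀ - ∫ s in (0 : ℝ)..t, g (θ ε ω s.toNNReal) (V (ε⁻¹ * s).toNNReal ω) := by
    intro ε hε
    filter_upwards [hθ ε hε] with ω hω t
    simpa only [div_eq_inv_mul] using hω t
  have hinteg : ∀ ε > 0, Integrable (fun ω => F (θ ε ω)) (π.bind P) := fun ε hε =>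
    Integrable.of_bound (SGP.aestronglyMeasurable_comp_solution hg (hV.measurable_rescaled ε⁻¹) hL
      (hsol ε hε) hF_cont.continuous) M (Eventually.of_forall fun ω => hM _)
  refine ⟨hinteg, ?_, hconst⟩
  rw [hconst, Metric.tendsto_nhds]
  intro η hη
  obtain ⟨δ, hδ, hFδ⟩ := hF_cont ζ (η / 2) (half_pos hη)
  obtain ⟨τ, hτ0, hτ⟩ : ∃ τ : ℝ, 0 < τ ∧ Real.exp (-τ) < δ / 2 := by
    obtain ⟨τ, h2, h3⟩ := ((Real.tendsto_exp_neg_atTop_nhds_zero.eventually_lt_const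
      (half_pos hδ)).and (eventually_gt_atTop 0)).exists
    exact ⟨τ, h3, h2⟩
  -- Chosen so that `Y ≤ r` yields `(Y + r) * exp (L * τ) ≤ δ / 2`; the other half of `δ` absorbs
  -- the tail `exp (-τ)`.
  set r : ℝ := δ / 4 * Real.exp (-(L * τ)) with hr
  have hr0 : 0 < r := by positivity
  have hre : r * Real.exp (L * τ) = δ / 4 := by
    rw [hr, mul_assoc, ← Real.exp_add, neg_add_cancel, Real.exp_zero, mul_one]
  obtain ⟨Y, hY0, hYi, hYlim, hY⟩ := SGP.exists_averaging_bound hV hπ.invariant hπ.unique hg hL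
    (x₀ := θ₀) (z := fun s => ζ s.toNNReal) (by fun_prop)
    (fun t ht => by simpa [ht] using hζ t.toNNReal) hτ0 hr0
  -- Markov's inequality in pointwise form: where `Y ≤ r` the paths are `δ`-close, and where `Y > r`
  -- the trivial bound `2 * M` is below `2 * M / r * Y`.
  have hbound : ∀ ε > 0, ∀ᵐ ω ∂(π.bind P),
      ‖F (θ ε ω) - F ζ‖ ≤ η / 2 + 2 * M / r * Y ε⁻¹ ω := by
    intro ε hε
    filter_upwards [hsol ε hε] with ω hω
    rw [← norm_neg, neg_sub, Real.norm_eq_abs]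
    by_cases hYr : Y ε⁻¹ ω ≤ r
    · have h1 := hY ε⁻¹ ω (fun s => θ ε ω s.toNNReal) (by fun_prop)
        (fun t ht => by simpa [ht] using hω t.toNNReal)
      have h2 : (Y ε⁻¹ ω + r) * Real.exp (L * τ) ≤ δ / 2 := by
        have := mul_le_mul_of_nonneg_right hYr (Real.exp_pos (L * τ)).le
        rw [add_mul]
        linarith
      have h3 : SGP.pathDist ζ (θ ε ω) < δ := by
        refine (SGP.pathDist_le (half_pos hδ).le hτ0.le fun s hs => ?_).trans_lt
          (by linarith : δ / 2 + Real.exp (-τ) < δ)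
        have h4 := h1 s ⟨s.coe_nonneg, hs⟩
        simp only [Real.toNNReal_coe] at h4
        rw [norm_sub_rev]
        exact h4.trans h2
      have h5 : 0 ≤ 2 * M / r * Y ε⁻¹ ω := mul_nonneg (by positivity) (hY0 _ _)
      linarith [hFδ _ h3]
    · have h1 : 2 * M ≤ 2 * M / r * Y ε⁻¹ ω := by
        rw [div_mul_eq_mul_div, le_div_iff₀ hr0]
        exact mul_le_mul_of_nonneg_left (not_le.1 hYr).le (by positivity)
      have h2 := abs_sub (F ζ) (F (θ ε ω))
      linarith [hM ζ, hM (θ ε ω)]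
  have hlim : Tendsto (fun ε : ℝ => 2 * M / r * ∫ ω, Y ε⁻¹ ω ∂(π.bind P)) (𝓝[>] 0) (𝓝 0) := by
    have := (hYlim.comp tendsto_inv_nhdsGT_zero).const_mul (2 * M / r)
    simpa using this
  filter_upwards [hlim.eventually_lt_const (half_pos hη), self_mem_nhdsWithin] with ε h1 hε
  have h2 : (∫ ω, F (θ ε ω) ∂(π.bind P)) - F ζ = ∫ ω, (F (θ ε ω) - F ζ) ∂(π.bind P) := by
    rw [integral_sub (hinteg ε hε) (integrable_const _), hconst]
  rw [dist_eq_norm, h2]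
  have h3 := norm_integral_le_of_norm_le
    ((integrable_const (η / 2)).add ((hYi ε⁻¹).const_mul (2 * M / r))) (hbound ε hε)
  refine h3.trans_lt ?_
  have h4 : ∫ ω, (η / 2 + 2 * M / r * Y ε⁻¹ ω) ∂(π.bind P) =
      η / 2 + 2 * M / r * ∫ ω, Y ε⁻¹ ω ∂(π.bind P) := by
    rw [integral_add (integrable_const _) ((hYi ε⁻¹).const_mul _), integral_const_mul]
    simp
  refine h4.trans_lt ?_
  linarith
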